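/- **Setting.** Let $A\in\mathbb R^{n\times n}$, $B\in\mathbb R^{n\times m}$, $E\in\mathbb R^{p\times n}$, $F\in\mathbb R^{p\times m}$, $\underline y,\bar y,\varepsilon_y\in\mathbb R^p$, $w\ge 0$ and an integer $N\ge 1$ be given. Consider the system $x(t+1)=Ax(t)+Bu(t)$ subject to $(x(t),u(t))\in\mathcal Y=\{(x,u):\underline y\le Ex+Fu\le\bar y\}$ (vector inequalities are componentwise). Write $\|v\|_P^2=v^\top Pv$. Assume that - $(A,B)$ is controllable and $\mathcal Y$ has non-empty interior; - $\varepsilon_y>0$ and $\underline y+\varepsilon_y<\bar y-\varepsilon_y$; - $Q\in\mathbb R^{n\times n}$ and $R\in\mathbb R^{m\times m}$ are symmetric positive definite, and $T_e,T_h\in\mathbb R^{n\times n}$ and $S_e,S_h\in\mathbb R^{m\times m}$ are diagonal positive definite; - $N$ is at least the controllability index of $(A,B)$, i.e. the smallest $j>0$ with $\operatorname{rank}[B,AB,\dots,A^{j-1}B]=n$. For $\mathbf x_H=(x_e,x_s,x_c)\in(\mathbb R^n)^3$ and $\mathbf u_H=(u_e,u_s,u_c)\in(\mathbb R^m)^3$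 put $y_\bullet=Ex_\bullet+Fu_\bullet$ for $\bullet\in\{e,s,c\}$, and, for $j\in\mathbb Z$, $$x_{hj}=x_e+x_s\sin(w(j-N))+x_c\cos(w(j-N)),\qquad u_{hj}=u_e+u_s\sin(w(j-N))+u_c\cos(w(j-N)).$$ Let $\mathcal H$ be the set of all $(\mathbf x_H,\mathbf u_H)$ with $$x_e=Ax_e+Bu_e,\quad x_s\cos w-x_c\sin w=Ax_s+Bu_s,\quad x_s\sin w+x_c\cos w=Ax_c+Bu_c,$$ $$\sqrt{y_{s(i)}^2+y_{c(i)}^2}\le y_{e(i)}-\underline y_{(i)}-\varepsilon_{y(i)},\qquad \sqrt{y_{s(i)}^2+y_{c(i)}^2}\le\bar y_{(i)}-\varepsilon_{y(i)}-y_{e(i)}\qquad(i=1,\dots,p).$$ For a reference $(x_r,u_r)\in\mathbb R^n\times\mathbb R^m$ let $$V_h(\mathbf x_H,\mathbf u_H)=\|x_e-x_r\|_{T_e}^2+\|u_e-u_r\|_{S_e}^2+\|x_s\|_{T_h}^2+\|x_c\|_{T_h}^2+\|u_s\|_{S_h}^2+\|u_c\|_{S_h}^2 .$$ The harmonic MPC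 (HMPC) problem at the state $x$ is to minimize $$\sum_{j=0}^{N-1}\big(\|x_j-x_{hj}\|_Q^2+\|u_j-u_{hj}\|_R^2\big)+V_h(\mathbf x_H,\mathbf u_H)$$ over $x_0,\dots,x_N$, $u_0,\dots,u_{N-1}$, $\mathbf x_H$, $\mathbf u_H$ subject to $x_0=x$; $x_{j+1}=Ax_j+Bu_j$ and $(x_j,u_j)\in\mathcal Y$ for $0\le j\le N-1$; $x_N=x_e+x_c$; and $(\mathbf x_H,\mathbf u_H)\in\mathcal H$. The feasibility region $\mathcal X$ is the set of states $x$ for which this problem is feasible (it does not depend on the reference). The HMPC control law applies $u(t)=u_0^*$, the first input of the optimal solution at $x=x(t)$; the closed loop is $x(t+1)=Ax(t)+Bu(t)$ with this $u(t)$. **Theorem.** Let $(x_r,u_r)\in\mathbb R^n\times\mathbb R^m$ be any reference and suppose that $\mathcal X\neq\emptyset$. Then: 1. For every $x\in\mathcal X$ the HMPC problem has exactly one optimal solution, so that the control law is well defined on $\mathcal X$. 2. There is a pair $(x_e^\circ,u_e^\circ)$ such that $\mathbf x_H^\circ=(x_e^\circ,0,0)$, $\mathbf u_H^\circ=(u_e^\circ,0,0)$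 is the unique minimizer of $V_h$ over $\mathcal H$ (the optimal artificial harmonic reference), and $(x_e^\circ,u_e^\circ)$ is the unique minimizer of $\|x-x_r\|_{T_e}^2+\|u-u_r\|_{S_e}^2$ over all steady states $x=Ax+Bu$ with $\underline y+\varepsilon_y\le Ex+Fu\le\bar y-\varepsilon_y$. 3. $x_e^\circ$ is an interior point of $\mathcal X$ and a Lyapunov stable equilibrium of the closed loop. 4. For every initial state $x(0)\in\mathcal X$, the closed loop satisfies $x(t)\in\mathcal X$ and $(x(t),u(t))\in\mathcal Y$ for all $t\ge 0$, and $x(t)\to x_e^\circ$ and $u(t)\to u_e^\circ$ as $t\to\infty$. -/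

import Mathlib

open Matrix Filter Topology

/-- The squared weighted norm `‖v‖²_P = ⟨v, P v⟩`. -/
def wnormSq {k : ℕ} (P : Matrix (Fin k) (Fin k) ℝ) (v : Fin k → ℝ) : ℝ := v ⬝ᵥ (P *ᵥ v)

/-- `z` is the one and only minimizer of `f` over the set `S`. -/
def IsUniqueMinimizer {α : Type} (f : α → ℝ) (S : Set α) (z : α) : Prop :=
  z ∈ S ∧ IsMinOn f S z ∧ ∀ z' ∈ S, IsMinOn f S z' → z' = z

/-! ### Controllability -/

/-- The state reached after `t` steps of `x(t+1) = A x(t) + B u(t)` from `x₀`. -/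
def stateAfter {n m : ℕ} (A : Matrix (Fin n) (Fin n) ℝ) (B : Matrix (Fin n) (Fin m) ℝ)
    (x₀ : Fin n → ℝ) (u : ℕ → Fin m → ℝ) : ℕ → Fin n → ℝ
  | 0 => x₀
  | t + 1 => A *ᵥ stateAfter A B x₀ u t + B *ᵥ u t

/-- Controllability: any state can be steered to any other state in finitely many steps. -/
def IsControllable {n m : ℕ} (A : Matrix (Fin n) (Fin n) ℝ) (B : Matrix (Fin n) (Fin m) ℝ) :
    Prop :=
  ∀ x₀ x₁ : Fin n → ℝ, ∃ (t : ℕ) (u : ℕ → Fin m → ℝ), stateAfter A B x₀ u t = x₁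

/-- The block matrix `[B, AB, …, A^{j-1}B]`. -/
def controllabilityMatrix {n m : ℕ} (A : Matrix (Fin n) (Fin n) ℝ)
    (B : Matrix (Fin n) (Fin m) ℝ) (j : ℕ) : Matrix (Fin n) (Fin j × Fin m) ℝ :=
  Matrix.of fun i q => (A ^ (q.1 : ℕ) * B) i q.2

/-- The smallest `j > 0` with `rank [B, AB, …, A^{j-1}B] = n` (for a controllable pair). -/
noncomputable def controllabilityIndex {n m : ℕ} (A : Matrix (Fin n) (Fin n) ℝ)
    (B : Matrix (Fin n) (Fin m) ℝ) : ℕ :=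
  sInf {j : ℕ | 0 < j ∧ (controllabilityMatrix A B j).rank = n}

/-! ### Data and decision variables of the harmonic MPC problem -/

/-- The system matrices, the constraint data and the tuning parameters of the controller. -/
structure HMPCData (n m p : ℕ) where
  A : Matrix (Fin n) (Fin n) ℝ
  B : Matrix (Fin n) (Fin m) ℝ
  E : Matrix (Fin p) (Fin n) ℝ
  F : Matrix (Fin p) (Fin m) ℝ
  /-- lower bound of the constraints -/
  ylo : Fin p → ℝ
  /-- upper bound of the constraints -/
  yhi : Fin p → ℝ
  /-- tightening `ε_y` of the constraints on the harmonic reference -/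
  eps : Fin p → ℝ
  /-- base frequency -/
  w : ℝ
  Q : Matrix (Fin n) (Fin n) ℝ
  R : Matrix (Fin m) (Fin m) ℝ
  Te : Matrix (Fin n) (Fin n) ℝ
  Th : Matrix (Fin n) (Fin n) ℝ
  Se : Matrix (Fin m) (Fin m) ℝ
  Sh : Matrix (Fin m) (Fin m) ℝ

/-- The parameters `(x_e, x_s, x_c, u_e, u_s, u_c)` of an artificial harmonic reference. -/
@[ext]
structure HarmonicVar (n m : ℕ) where
  xe : Fin n → ℝ
  xs : Fin n → ℝ
  xc : Fin n → ℝ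
  ue : Fin m → ℝ
  us : Fin m → ℝ
  uc : Fin m → ℝ

/-- The state `x_{hj} = x_e + x_s sin(w(j-N)) + x_c cos(w(j-N))` of the harmonic reference. -/
noncomputable def HarmonicVar.stateAt {n m : ℕ} (h : HarmonicVar n m) (w : ℝ) (N : ℕ) (j : ℤ) :
    Fin n → ℝ :=
  h.xe + Real.sin (w * ((j : ℝ) - N)) • h.xs + Real.cos (w * ((j : ℝ) - N)) • h.xc

/-- The input `u_{hj} = u_e + u_s sin(w(j-N)) + u_c cos(w(j-N))` of the harmonic reference. -/
noncomputable def HarmonicVar.inputAt {n m : ℕ} (h : HarmonicVar n m) (w : ℝ) (N : ℕ) (j : ℤ) :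
    Fin m → ℝ :=
  h.ue + Real.sin (w * ((j : ℝ) - N)) • h.us + Real.cos (w * ((j : ℝ) - N)) • h.uc

/-- The harmonic variable of a constant reference: `((x_e, 0, 0), (u_e, 0, 0))`. -/
def HarmonicVar.const {n m : ℕ} (xe : Fin n → ℝ) (ue : Fin m → ℝ) : HarmonicVar n m where
  xe := xe
  xs := 0
  xc := 0
  ue := ue
  us := 0
  uc := 0

/-- All decision variables: predicted states `x_0, …, x_N`, predicted inputs `u_0, …, u_{N-1}`
and the harmonic reference. -/
@[ext]
structure HMPCDecision (n m N : ℕ) where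
  x : Fin (N + 1) → Fin n → ℝ
  u : Fin N → Fin m → ℝ
  h : HarmonicVar n m

namespace HMPCData

variable {n m p : ℕ} (D : HMPCData n m p)

/-- The system constraint set `{(x, u) : ylo ≤ E x + F u ≤ yhi}`. -/
def constraintSet : Set ((Fin n → ℝ) × (Fin m → ℝ)) :=
  {z | D.ylo ≤ D.E *ᵥ z.1 + D.F *ᵥ z.2 ∧ D.E *ᵥ z.1 + D.F *ᵥ z.2 ≤ D.yhi}

/-- Steady states of the system that satisfy the constraints tightened by `ε_y`. -/
def tightenedSteadyStates : Set ((Fin n → ℝ) × (Fin m → ℝ)) :=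
  {z | z.1 = D.A *ᵥ z.1 + D.B *ᵥ z.2 ∧
    D.ylo + D.eps ≤ D.E *ᵥ z.1 + D.F *ᵥ z.2 ∧ D.E *ᵥ z.1 + D.F *ᵥ z.2 ≤ D.yhi - D.eps}

/-- The output `E x + F u`, componentwise on `(x_e, u_e)`, `(x_s, u_s)`, `(x_c, u_c)`. -/
def output (x : Fin n → ℝ) (u : Fin m → ℝ) : Fin p → ℝ := D.E *ᵥ x + D.F *ᵥ u

/-- The harmonic references satisfying the dynamics constraints and the second order cone
constraints of the harmonic MPC problem. -/
def harmonicSet : Set (HarmonicVar n m) :=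
  {h | h.xe = D.A *ᵥ h.xe + D.B *ᵥ h.ue ∧
    Real.cos D.w • h.xs - Real.sin D.w • h.xc = D.A *ᵥ h.xs + D.B *ᵥ h.us ∧
    Real.sin D.w • h.xs + Real.cos D.w • h.xc = D.A *ᵥ h.xc + D.B *ᵥ h.uc ∧
    (∀ i, Real.sqrt ((D.output h.xs h.us i) ^ 2 + (D.output h.xc h.uc i) ^ 2)
      ≤ D.output h.xe h.ue i - D.ylo i - D.eps i) ∧
    (∀ i, Real.sqrt ((D.output h.xs h.us i) ^ 2 + (D.output h.xc h.uc i) ^ 2)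
      ≤ D.yhi i - D.eps i - D.output h.xe h.ue i)}

/-- The feasible set of the harmonic MPC problem with horizon `N` at the current state `x`. -/
def feasibleSet (N : ℕ) (x : Fin n → ℝ) : Set (HMPCDecision n m N) :=
  {z | (∀ j : Fin N, z.x j.succ = D.A *ᵥ z.x j.castSucc + D.B *ᵥ z.u j) ∧
    (∀ j : Fin N, (z.x j.castSucc, z.u j) ∈ D.constraintSet) ∧
    z.x 0 = x ∧
    z.x (Fin.last N) = z.h.xe + z.h.xc ∧
    z.h ∈ D.harmonicSet}

/-- The set of states for which the harmonic MPC problem is feasible. -/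
def feasibilityRegion (N : ℕ) : Set (Fin n → ℝ) := {x | (D.feasibleSet N x).Nonempty}

/-- The distance of a steady state `(x, u)` to the reference. -/
def steadyCost (xr : Fin n → ℝ) (ur : Fin m → ℝ) (z : (Fin n → ℝ) × (Fin m → ℝ)) : ℝ :=
  wnormSq D.Te (z.1 - xr) + wnormSq D.Se (z.2 - ur)

/-- The offset cost `V_h`. -/
def offsetCost (xr : Fin n → ℝ) (ur : Fin m → ℝ) (h : HarmonicVar n m) : ℝ :=
  wnormSq D.Te (h.xe - xr) + wnormSq D.Se (h.ue - ur)
    + wnormSq D.Th h.xs + wnormSq D.Th h.xc + wnormSq D.Sh h.us + wnormSq D.Sh h.uc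

/-- The sum of the stage costs `ℓ_h`. -/
noncomputable def stageCost (N : ℕ) (z : HMPCDecision n m N) : ℝ :=
  ∑ j : Fin N, (wnormSq D.Q (z.x j.castSucc - z.h.stateAt D.w N (j : ℕ))
    + wnormSq D.R (z.u j - z.h.inputAt D.w N (j : ℕ)))

/-- The total cost `J_h = ℓ_h + V_h`. -/
noncomputable def totalCost (N : ℕ) (xr : Fin n → ℝ) (ur : Fin m → ℝ)
    (z : HMPCDecision n m N) : ℝ :=
  D.stageCost N z + D.offsetCost xr ur z.h

open Classical in
/-- The harmonic MPC control law: the first input `u_0^*` of a minimizer of the problem at the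
current state `x` (and `0` where the problem has no minimizer). -/
noncomputable def controlLaw (N : ℕ) [NeZero N] (xr : Fin n → ℝ) (ur : Fin m → ℝ)
    (x : Fin n → ℝ) : Fin m → ℝ :=
  if hz : ∃ z ∈ D.feasibleSet N x, IsMinOn (D.totalCost N xr ur) (D.feasibleSet N x) z
  then hz.choose.u 0 else 0

/-- One step of the closed loop. -/
noncomputable def closedLoop (N : ℕ) [NeZero N] (xr : Fin n → ℝ) (ur : Fin m → ℝ)
    (x : Fin n → ℝ) : Fin n → ℝ :=
  D.A *ᵥ x + D.B *ᵥ D.controlLaw N xr ur x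

/-- The closed-loop state `x(t)` from the initial state `x(0) = x₀`. -/
noncomputable def closedLoopState (N : ℕ) [NeZero N] (xr : Fin n → ℝ) (ur : Fin m → ℝ)
    (x₀ : Fin n → ℝ) (t : ℕ) : Fin n → ℝ :=
  (D.closedLoop N xr ur)^[t] x₀

/-- The closed-loop input `u(t)` from the initial state `x(0) = x₀`. -/
noncomputable def closedLoopInput (N : ℕ) [NeZero N] (xr : Fin n → ℝ) (ur : Fin m → ℝ)
    (x₀ : Fin n → ℝ) (t : ℕ) : Fin m → ℝ :=
  D.controlLaw N xr ur (D.closedLoopState N xr ur x₀ t)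

/-- The standing assumptions on the system, the constraints and the weights. -/
structure Assumptions : Prop where
  controllable : IsControllable D.A D.B
  interior_nonempty : (interior D.constraintSet).Nonempty
  w_nonneg : 0 ≤ D.w
  eps_pos : ∀ i, 0 < D.eps i
  tightened_lt : ∀ i, D.ylo i + D.eps i < D.yhi i - D.eps i
  Q_posDef : D.Q.PosDef
  R_posDef : D.R.PosDef
  Te_posDef : D.Te.PosDef
  Te_diag : D.Te.IsDiag
  Th_posDef : D.Th.PosDef
  Th_diag : D.Th.IsDiag
  Se_posDef : D.Se.PosDef
  Se_diag : D.Se.IsDiag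
  Sh_posDef : D.Sh.PosDef
  Sh_diag : D.Sh.IsDiag

end HMPCData

/-- Lyapunov stability (in the Euclidean norm) of the equilibrium `xeq` of `x(t+1) = f(x(t))`. -/
def IsLyapunovStable {n : ℕ} (f : (Fin n → ℝ) → (Fin n → ℝ)) (xeq : Fin n → ℝ) : Prop :=
  f xeq = xeq ∧ ∀ η > 0, ∃ δ > 0, ∀ x : Fin n → ℝ, ‖WithLp.toLp 2 (x - xeq)‖ < δ →
    ∀ t : ℕ, ‖WithLp.toLp 2 (f^[t] x - xeq)‖ < η

/-!
The three ingredients are a description of the admissible harmonic references by phases, the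
shifted solution, and strong convexity.

*Phases.* A disc constraint is the conjunction of the half-plane constraints in all directions
(`sqrt_sq_add_sq_le_iff`). Hence a harmonic reference is admissible exactly when at every phase it
follows the dynamics and satisfies the tightened constraints (`HMPCData.mem_harmonicSet_iff`), so
that the set of these references is closed, convex and invariant under a shift in time
(`HMPCData.rotate_mem_harmonicSet`).

*Strong convexity.* All costs have the form `q (z - r)` with `q` a positive definite quadratic form,
so that minimizers over closed convex sets exist, and every other point `y` costs at least
`q (y - z)` more than the minimizer `z` (`QuadraticMap.add_apply_sub_le_of_isMinOn`). Dropping the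
oscillating part of an admissible reference keeps it admissible and lowers the offset cost, which
identifies the optimal reference with the optimal steady state
(`HMPCData.Assumptions.exists_optimal_reference`).

*Convergence.* The shifted solution is feasible at the next state and costs less by the first stage
cost (`HMPCData.totalCost_shift`). The optimal costs therefore converge, the first stage costs tend
to zero, and the shifted solutions become asymptotically optimal; by strong convexity they approach
the next optimal solutions, which carries the vanishing of the stage cost from each step of the
horizon to the following one (`HMPCData.OptimalRun.tendsto_deviation`). When the predicted
trajectory is close to its reference, the tightening leaves room to move the reference a fixed
fraction of the way to the optimal one, the trajectory being adapted by controllability; optimality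
then bounds the distance of the reference from the optimal one by the tracking cost
(`HMPCData.OptimalRun.tendsto_harmonic`).

*Stability.* The optimal cost does not increase along the closed loop. Its excess over the optimal
offset cost dominates the squared distance to the optimal steady state
(`HMPCData.costForm_sub_const_le`) and, again by controllability and tightening, is small near
this state
(`HMPCData.Assumptions.eventually_exists_feasible`).
-/

/-! ### Positive definite quadratic forms in finite dimension -/

namespace QuadraticMap

theorem apply_lineMap {V : Type*} [AddCommGroup V] [Module ℝ V] (q : QuadraticForm ℝ V)
    (a b : V) (t : ℝ) :
    q (a + t • (b - a)) = (1 - t) * q a + t * q b - t * (1 - t) * q (b - a) := by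
  have e1 : q (a + t • (b - a)) = q a + q (t • (b - a)) + polar q a (t • (b - a)) :=
    QuadraticMap.map_add _ _ _
  have e2 : q b = q a + q (b - a) + polar q a (b - a) := by
    rw [← QuadraticMap.map_add]; congr 1; abel
  rw [QuadraticMap.map_smul, QuadraticMap.polar_smul_right] at e1
  simp only [smul_eq_mul] at e1
  rw [e1, e2]; ring

theorem apply_add_le {V : Type*} [AddCommGroup V] [Module ℝ V] (q : QuadraticForm ℝ V)
    (hq : ∀ x, 0 ≤ q x) (a b : V) : q (a + b) ≤ 2 * q a + 2 * q b := by
  have h := q.apply_lineMap (a + a) (b + b) (1 / 2)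
  have e : a + a + (1 / 2 : ℝ) • (b + b - (a + a)) = a + b := by module
  have h0 := hq (b + b - (a + a))
  rw [e, q.map_add_self, q.map_add_self] at h
  simp only [nsmul_eq_mul] at h
  push_cast at h
  linarith

/-- On a convex set, the value of `q (· - r)` at a point exceeds the minimum by at least `q`
of the distance to the minimizer. -/
theorem add_apply_sub_le_of_isMinOn {V : Type*} [AddCommGroup V] [Module ℝ V]
    (q : QuadraticForm ℝ V) {S : Set V} (hS : Convex ℝ S) {r z y : V} (hz : z ∈ S)
    (hmin : IsMinOn (fun v => q (v - r)) S z) (hy : y ∈ S) :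
    q (z - r) + q (y - z) ≤ q (y - r) := by
  have key : ∀ t : ℝ, 0 < t → t ≤ 1 →
      (1 - t) * q (y - z) ≤ q (y - r) - q (z - r) := by
    intro t ht ht1
    have hm : z + t • (y - z) ∈ S := hS.add_smul_sub_mem hz hy ⟨ht.le, ht1⟩
    have h1 : q (z - r) ≤ q (z + t • (y - z) - r) := hmin hm
    have e : z + t • (y - z) - r = (z - r) + t • ((y - r) - (z - r)) := by module
    rw [e, q.apply_lineMap, sub_sub_sub_cancel_right] at h1
    have : t * ((1 - t) * q (y - z)) ≤ t * (q (y - r) - q (z - r)) := by linarith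
    exact le_of_mul_le_mul_left this ht
  have hlim : Tendsto (fun t : ℝ => (1 - t) * q (y - z)) (𝓝[>] 0) (𝓝 ((1 - 0) * q (y - z))) :=
    ((continuous_const.sub continuous_id).mul continuous_const).continuousWithinAt.tendsto
  have := le_of_tendsto hlim (b := q (y - r) - q (z - r)) <| by
    filter_upwards [Ioc_mem_nhdsGT one_pos] with t ht using key t ht.1 ht.2
  linarith

variable {V : Type*} [NormedAddCommGroup V] [NormedSpace ℝ V] [FiniteDimensional ℝ V]

theorem continuous_of_finiteDimensional (q : QuadraticForm ℝ V) : Continuous q := by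
  have h : (fun x => (associated q).toContinuousBilinearMap x x) = q := by
    funext x
    simp only [LinearMap.toContinuousBilinearMap_apply]
    exact associated_eq_self_apply ℝ q x
  rw [← h]
  fun_prop

theorem PosDef.exists_pos_mul_norm_sq_le {q : QuadraticForm ℝ V} (hq : q.PosDef) :
    ∃ c > 0, ∀ x, c * ‖x‖ ^ 2 ≤ q x := by
  rcases subsingleton_or_nontrivial V with h | h
  · exact ⟨1, one_pos, fun x => by simp [Subsingleton.elim x 0]⟩
  have : ProperSpace V := FiniteDimensional.proper ℝ V
  obtain ⟨z, hz, hmin⟩ := (isCompact_sphere (0 : V) 1).exists_isMinOn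
    (NormedSpace.sphere_nonempty.2 zero_le_one) q.continuous_of_finiteDimensional.continuousOn
  have hz0 : z ≠ 0 := by rintro rfl; simp at hz
  refine ⟨q z, hq z hz0, fun x => ?_⟩
  rcases eq_or_ne x 0 with rfl | hx
  · simp
  have hx' : 0 < ‖x‖ := norm_pos_iff.2 hx
  have hm : q z ≤ q (‖x‖⁻¹ • x) := hmin (by simp [norm_smul, hx'.ne'])
  rw [QuadraticMap.map_smul, smul_eq_mul] at hm
  calc q z * ‖x‖ ^ 2 ≤ (‖x‖⁻¹ * ‖x‖⁻¹ * q x) * ‖x‖ ^ 2 := by gcongr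
    _ = q x := by field_simp

/-- A positive definite form dominates the square of every linear map. -/
theorem PosDef.exists_norm_sq_le {F : Type*} [NormedAddCommGroup F] [NormedSpace ℝ F]
    {q : QuadraticForm ℝ V} (hq : q.PosDef) (L : V →ₗ[ℝ] F) :
    ∃ C > 0, ∀ x, ‖L x‖ ^ 2 ≤ C * q x := by
  obtain ⟨c, hc, h⟩ := hq.exists_pos_mul_norm_sq_le
  set L' := L.toContinuousLinearMap
  refine ⟨(‖L'‖ ^ 2 + 1) / c, by positivity, fun x => ?_⟩
  have h1 : ‖L x‖ ≤ ‖L'‖ * ‖x‖ := L'.le_opNorm x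
  have h2 := h x
  calc ‖L x‖ ^ 2 ≤ (‖L'‖ * ‖x‖) ^ 2 := by gcongr
    _ ≤ (‖L'‖ ^ 2 + 1) / c * (c * ‖x‖ ^ 2) := by
      have : (‖L'‖ ^ 2 + 1) / c * (c * ‖x‖ ^ 2) = (‖L'‖ ^ 2 + 1) * ‖x‖ ^ 2 := by field_simp
      rw [this]; nlinarith [sq_nonneg ‖x‖]
    _ ≤ _ := by gcongr

/-- A positive definite form dominates every quadratic form. -/
theorem PosDef.exists_apply_le {q : QuadraticForm ℝ V} (hq : q.PosDef) (q' : QuadraticForm ℝ V) :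
    ∃ C > 0, ∀ x, q' x ≤ C * q x := by
  obtain ⟨c, hc, h⟩ := hq.exists_pos_mul_norm_sq_le
  set b := (associated q').toContinuousBilinearMap
  refine ⟨(‖b‖ + 1) / c, by positivity, fun x => ?_⟩
  have e : q' x = b x x := (associated_eq_self_apply ℝ q' x).symm
  have h1 : q' x ≤ ‖b‖ * ‖x‖ * ‖x‖ := by
    rw [e]; exact (le_abs_self _).trans (b.le_opNorm₂ x x)
  calc q' x ≤ (‖b‖ + 1) * ‖x‖ ^ 2 := by nlinarith [sq_nonneg ‖x‖]
    _ = (‖b‖ + 1) / c * (c * ‖x‖ ^ 2) := by field_simp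
    _ ≤ _ := by gcongr; exact h x

theorem PosDef.tendsto_zero {q : QuadraticForm ℝ V} (hq : q.PosDef) {ι : Type*} {l : Filter ι}
    {v : ι → V} (h : Tendsto (fun t => q (v t)) l (𝓝 0)) : Tendsto v l (𝓝 0) := by
  obtain ⟨C, hC, hb⟩ := hq.exists_norm_sq_le LinearMap.id
  rw [tendsto_zero_iff_norm_tendsto_zero]
  have h2 : Tendsto (fun t => √(C * q (v t))) l (𝓝 0) := by
    have := (h.const_mul C).sqrt
    simpa using this
  exact squeeze_zero (fun _ => norm_nonneg _) (fun t => Real.le_sqrt_of_sq_le (hb (v t))) h2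

/-- A positive definite form has a minimizer, centred anywhere, on every nonempty closed set. -/
theorem PosDef.exists_isMinOn {q : QuadraticForm ℝ V} (hq : q.PosDef) {S : Set V}
    (hS : IsClosed S) (hne : S.Nonempty) (r : V) :
    ∃ z ∈ S, IsMinOn (fun v => q (v - r)) S z := by
  have : ProperSpace V := FiniteDimensional.proper ℝ V
  obtain ⟨z₀, hz₀⟩ := hne
  obtain ⟨c, hc, h⟩ := hq.exists_pos_mul_norm_sq_le
  have hcont : Continuous fun v => q (v - r) :=
    q.continuous_of_finiteDimensional.comp (continuous_id.sub continuous_const)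
  refine hcont.continuousOn.exists_isMinOn' hS hz₀ ?_
  refine Filter.Eventually.filter_mono inf_le_left ?_
  have hK : IsCompact (Metric.closedBall r (q (z₀ - r) / c + 1)) := isCompact_closedBall _ _
  filter_upwards [hK.compl_mem_cocompact] with v hv
  simp only [Set.mem_compl_iff, Metric.mem_closedBall, not_le, dist_eq_norm] at hv
  have h0 : 0 ≤ q (z₀ - r) := hq.nonneg _
  have h1 := h (v - r)
  have h2 : q (z₀ - r) / c ≤ ‖v - r‖ ^ 2 := by
    have : 0 ≤ q (z₀ - r) / c := by positivity
    nlinarith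
  rw [div_le_iff₀ hc] at h2
  linarith

end QuadraticMap

/-- The quadratic form `v ↦ ‖v‖²_P`. -/
noncomputable def wnormForm {k : ℕ} (P : Matrix (Fin k) (Fin k) ℝ) :
    QuadraticForm ℝ (Fin k → ℝ) := P.toQuadraticForm'

@[simp] theorem wnormForm_apply {k : ℕ} (P : Matrix (Fin k) (Fin k) ℝ) (v : Fin k → ℝ) :
    wnormForm P v = wnormSq P v := by
  simp [wnormForm, wnormSq, Matrix.toQuadraticForm', Matrix.toLinearMap₂'_apply']

theorem wnormForm_posDef {k : ℕ} {P : Matrix (Fin k) (Fin k) ℝ} (hP : P.PosDef) :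
    (wnormForm P).PosDef := fun v hv => by
  simpa [wnormSq] using hP.dotProduct_mulVec_pos hv

theorem wnormSq_nonneg {k : ℕ} {P : Matrix (Fin k) (Fin k) ℝ} (hP : P.PosDef) (v : Fin k → ℝ) :
    0 ≤ wnormSq P v := by
  simpa using (wnormForm_posDef hP).nonneg v

theorem wnormSq_eq_zero {k : ℕ} {P : Matrix (Fin k) (Fin k) ℝ} (hP : P.PosDef)
    {v : Fin k → ℝ} : wnormSq P v = 0 ↔ v = 0 := by
  simpa using (wnormForm_posDef hP).anisotropic.eq_zero_iff (x := v)

/-- Rotating a pair of vectors by an angle keeps the sum of their squared weighted norms. -/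
theorem wnormSq_rotate {k : ℕ} (P : Matrix (Fin k) (Fin k) ℝ) (a b : Fin k → ℝ) (θ : ℝ) :
    wnormSq P (Real.cos θ • a - Real.sin θ • b) + wnormSq P (Real.sin θ • a + Real.cos θ • b)
      = wnormSq P a + wnormSq P b := by
  simp only [wnormSq, mulVec_sub, mulVec_add, mulVec_smul, dotProduct_sub, dotProduct_add,
    sub_dotProduct, add_dotProduct, smul_dotProduct, dotProduct_smul, smul_eq_mul]
  linear_combination (a ⬝ᵥ P *ᵥ a + b ⬝ᵥ P *ᵥ b) * Real.sin_sq_add_cos_sq θ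

/-- A disc constraint is the conjunction of the linear constraints in all directions. -/
theorem sqrt_sq_add_sq_le_iff {a b c : ℝ} :
    √(a ^ 2 + b ^ 2) ≤ c ↔ ∀ θ : ℝ, Real.sin θ * a + Real.cos θ * b ≤ c := by
  constructor
  · intro h θ
    refine (Real.le_sqrt_of_sq_le ?_).trans h
    nlinarith [Real.sin_sq_add_cos_sq θ, sq_nonneg (Real.cos θ * a - Real.sin θ * b)]
  · intro h
    have hn : ‖(⟨b, a⟩ : ℂ)‖ = √(a ^ 2 + b ^ 2) := by
      rw [Complex.norm_def, Complex.normSq_mk]; congr 1; ring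
    have h1 := h (Complex.arg ⟨b, a⟩)
    have hs := Complex.norm_mul_sin_arg ⟨b, a⟩
    have hc := Complex.norm_mul_cos_arg ⟨b, a⟩
    rw [hn] at hs hc
    simp only at hs hc
    set s := √(a ^ 2 + b ^ 2)
    have hss : s * s = a ^ 2 + b ^ 2 := Real.mul_self_sqrt (by positivity)
    rcases (Real.sqrt_nonneg (a ^ 2 + b ^ 2)).eq_or_lt with h0 | h0
    · have hs0 : s = 0 := h0.symm
      have ha : a = 0 := by nlinarith
      have hb : b = 0 := by nlinarith
      rw [ha, hb] at h1
      simp only [mul_zero, add_zero] at h1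
      rw [hs0]; exact h1
    · refine le_of_mul_le_mul_left ?_ h0
      change s * s ≤ s * c
      calc s * s = (s * Real.sin (Complex.arg ⟨b, a⟩)) * a
            + (s * Real.cos (Complex.arg ⟨b, a⟩)) * b := by rw [hs, hc, hss]; ring
        _ = s * (Real.sin (Complex.arg ⟨b, a⟩) * a + Real.cos (Complex.arg ⟨b, a⟩) * b) := by ring
        _ ≤ s * c := by gcongr

/-! ### Vector space structure on the decision variables -/

namespace HarmonicVar

variable {n m : ℕ}

/-- Harmonic parameters as a product of coordinate spaces; this carries the vector space and
norm structures. -/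
def equivProd (n m : ℕ) : HarmonicVar n m ≃
    ((Fin n → ℝ) × (Fin n → ℝ) × (Fin n → ℝ)) × ((Fin m → ℝ) × (Fin m → ℝ) × (Fin m → ℝ)) where
  toFun h := ((h.xe, h.xs, h.xc), (h.ue, h.us, h.uc))
  invFun v := ⟨v.1.1, v.1.2.1, v.1.2.2, v.2.1, v.2.2.1, v.2.2.2⟩
  left_inv _ := rfl
  right_inv _ := rfl

noncomputable instance : AddCommGroup (HarmonicVar n m) := (equivProd n m).addCommGroup

noncomputable instance : Module ℝ (HarmonicVar n m) := (equivProd n m).module ℝ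

/-- `HarmonicVar.equivProd` as a linear equivalence. -/
noncomputable def linearEquivProd (n m : ℕ) : HarmonicVar n m ≃ₗ[ℝ]
    ((Fin n → ℝ) × (Fin n → ℝ) × (Fin n → ℝ)) × ((Fin m → ℝ) × (Fin m → ℝ) × (Fin m → ℝ)) :=
  { equivProd n m with
    map_add' := fun _ _ => rfl
    map_smul' := fun _ _ => rfl }

noncomputable instance : NormedAddCommGroup (HarmonicVar n m) :=
  NormedAddCommGroup.induced _ _ (linearEquivProd n m).toLinearMap (linearEquivProd n m).injective

noncomputable instance : NormedSpace ℝ (HarmonicVar n m) :=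
  NormedSpace.induced ℝ _ _ (linearEquivProd n m).toLinearMap

instance : FiniteDimensional ℝ (HarmonicVar n m) :=
  (linearEquivProd n m).symm.finiteDimensional

@[simp] theorem add_xe (a b : HarmonicVar n m) : (a + b).xe = a.xe + b.xe := rfl
@[simp] theorem add_xc (a b : HarmonicVar n m) : (a + b).xc = a.xc + b.xc := rfl
@[simp] theorem sub_xe (a b : HarmonicVar n m) : (a - b).xe = a.xe - b.xe := rfl
@[simp] theorem sub_xs (a b : HarmonicVar n m) : (a - b).xs = a.xs - b.xs := rfl
@[simp] theorem sub_xc (a b : HarmonicVar n m) : (a - b).xc = a.xc - b.xc := rfl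
@[simp] theorem sub_ue (a b : HarmonicVar n m) : (a - b).ue = a.ue - b.ue := rfl
@[simp] theorem sub_us (a b : HarmonicVar n m) : (a - b).us = a.us - b.us := rfl
@[simp] theorem sub_uc (a b : HarmonicVar n m) : (a - b).uc = a.uc - b.uc := rfl

/-- The parameter `x_e` as a linear map. -/
noncomputable def xeL : HarmonicVar n m →ₗ[ℝ] (Fin n → ℝ) where
  toFun h := h.xe
  map_add' _ _ := rfl
  map_smul' _ _ := rfl

/-- The parameter `x_s` as a linear map. -/
noncomputable def xsL : HarmonicVar n m →ₗ[ℝ] (Fin n → ℝ) where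
  toFun h := h.xs
  map_add' _ _ := rfl
  map_smul' _ _ := rfl

/-- The parameter `x_c` as a linear map. -/
noncomputable def xcL : HarmonicVar n m →ₗ[ℝ] (Fin n → ℝ) where
  toFun h := h.xc
  map_add' _ _ := rfl
  map_smul' _ _ := rfl

/-- The parameter `u_e` as a linear map. -/
noncomputable def ueL : HarmonicVar n m →ₗ[ℝ] (Fin m → ℝ) where
  toFun h := h.ue
  map_add' _ _ := rfl
  map_smul' _ _ := rfl

/-- The parameter `u_s` as a linear map. -/
noncomputable def usL : HarmonicVar n m →ₗ[ℝ] (Fin m → ℝ) where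
  toFun h := h.us
  map_add' _ _ := rfl
  map_smul' _ _ := rfl

/-- The parameter `u_c` as a linear map. -/
noncomputable def ucL : HarmonicVar n m →ₗ[ℝ] (Fin m → ℝ) where
  toFun h := h.uc
  map_add' _ _ := rfl
  map_smul' _ _ := rfl

@[simp] theorem xeL_apply (h : HarmonicVar n m) : xeL h = h.xe := rfl
@[simp] theorem xsL_apply (h : HarmonicVar n m) : xsL h = h.xs := rfl
@[simp] theorem xcL_apply (h : HarmonicVar n m) : xcL h = h.xc := rfl
@[simp] theorem ueL_apply (h : HarmonicVar n m) : ueL h = h.ue := rfl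
@[simp] theorem usL_apply (h : HarmonicVar n m) : usL h = h.us := rfl
@[simp] theorem ucL_apply (h : HarmonicVar n m) : ucL h = h.uc := rfl

/-- State and input of the harmonic reference at the phase `θ`, as a linear map of the
parameters. -/
noncomputable def atPhase (θ : ℝ) : HarmonicVar n m →ₗ[ℝ] (Fin n → ℝ) × (Fin m → ℝ) :=
  (xeL + Real.sin θ • xsL + Real.cos θ • xcL).prod (ueL + Real.sin θ • usL + Real.cos θ • ucL)

theorem atPhase_apply (θ : ℝ) (h : HarmonicVar n m) : atPhase θ h =
    (h.xe + Real.sin θ • h.xs + Real.cos θ • h.xc,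
      h.ue + Real.sin θ • h.us + Real.cos θ • h.uc) := rfl

theorem atPhase_zero (h : HarmonicVar n m) : atPhase 0 h = (h.xe + h.xc, h.ue + h.uc) := by
  simp [atPhase_apply]

@[simp] theorem atPhase_const (θ : ℝ) (x : Fin n → ℝ) (u : Fin m → ℝ) :
    atPhase θ (const x u) = (x, u) := by
  simp [atPhase_apply, const]

/-- The harmonic reference advanced by the angle `w`. -/
noncomputable def rotate (w : ℝ) (h : HarmonicVar n m) : HarmonicVar n m where
  xe := h.xe
  xs := Real.cos w • h.xs - Real.sin w • h.xc
  xc := Real.sin w • h.xs + Real.cos w • h.xc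
  ue := h.ue
  us := Real.cos w • h.us - Real.sin w • h.uc
  uc := Real.sin w • h.us + Real.cos w • h.uc

theorem atPhase_rotate (θ w : ℝ) (h : HarmonicVar n m) :
    atPhase θ (rotate w h) = atPhase (θ + w) h := by
  simp only [atPhase_apply, rotate, Real.sin_add, Real.cos_add]
  refine Prod.ext ?_ ?_ <;> dsimp only <;> module

end HarmonicVar

namespace HMPCDecision

variable {n m N : ℕ}

/-- Decision variables as a product of coordinate spaces; this carries the vector space and
norm structures. -/
def equivProd (n m N : ℕ) : HMPCDecision n m N ≃
    (Fin (N + 1) → Fin n → ℝ) × (Fin N → Fin m → ℝ) × HarmonicVar n m where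
  toFun z := (z.x, z.u, z.h)
  invFun v := ⟨v.1, v.2.1, v.2.2⟩
  left_inv _ := rfl
  right_inv _ := rfl

noncomputable instance : AddCommGroup (HMPCDecision n m N) := (equivProd n m N).addCommGroup

noncomputable instance : Module ℝ (HMPCDecision n m N) := (equivProd n m N).module ℝ

/-- `HMPCDecision.equivProd` as a linear equivalence. -/
noncomputable def linearEquivProd (n m N : ℕ) : HMPCDecision n m N ≃ₗ[ℝ]
    (Fin (N + 1) → Fin n → ℝ) × (Fin N → Fin m → ℝ) × HarmonicVar n m :=
  { equivProd n m N with
    map_add' := fun _ _ => rfl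
    map_smul' := fun _ _ => rfl }

noncomputable instance : NormedAddCommGroup (HMPCDecision n m N) :=
  NormedAddCommGroup.induced _ _ (linearEquivProd n m N).toLinearMap
    (linearEquivProd n m N).injective

noncomputable instance : NormedSpace ℝ (HMPCDecision n m N) :=
  NormedSpace.induced ℝ _ _ (linearEquivProd n m N).toLinearMap

instance : FiniteDimensional ℝ (HMPCDecision n m N) :=
  (linearEquivProd n m N).symm.finiteDimensional

@[simp] theorem add_x (a b : HMPCDecision n m N) : (a + b).x = a.x + b.x := rfl
@[simp] theorem add_h (a b : HMPCDecision n m N) : (a + b).h = a.h + b.h := rfl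
@[simp] theorem sub_h (a b : HMPCDecision n m N) : (a - b).h = a.h - b.h := rfl

/-- The predicted state at step `j` as a linear map. -/
noncomputable def xL (j : Fin (N + 1)) : HMPCDecision n m N →ₗ[ℝ] (Fin n → ℝ) where
  toFun z := z.x j
  map_add' _ _ := rfl
  map_smul' _ _ := rfl

/-- The predicted state and input at step `j` as a linear map. -/
noncomputable def xuL (j : Fin N) : HMPCDecision n m N →ₗ[ℝ] (Fin n → ℝ) × (Fin m → ℝ) where
  toFun z := (z.x j.castSucc, z.u j)
  map_add' _ _ := rfl
  map_smul' _ _ := rfl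

/-- The harmonic reference of a decision as a linear map. -/
noncomputable def hL : HMPCDecision n m N →ₗ[ℝ] HarmonicVar n m where
  toFun z := z.h
  map_add' _ _ := rfl
  map_smul' _ _ := rfl

@[simp] theorem xL_apply (j : Fin (N + 1)) (z : HMPCDecision n m N) : xL j z = z.x j := rfl
@[simp] theorem xuL_apply (j : Fin N) (z : HMPCDecision n m N) :
    xuL j z = (z.x j.castSucc, z.u j) := rfl
@[simp] theorem hL_apply (z : HMPCDecision n m N) : hL z = z.h := rfl

/-- Deviation of the predicted state and input at step `j` from the harmonic reference. -/
noncomputable def deviation (w : ℝ) (j : Fin N) :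
    HMPCDecision n m N →ₗ[ℝ] (Fin n → ℝ) × (Fin m → ℝ) :=
  xuL j - (HarmonicVar.atPhase (w * ((j : ℕ) - N))).comp hL

theorem deviation_apply (w : ℝ) (j : Fin N) (z : HMPCDecision n m N) :
    deviation w j z = (z.x j.castSucc, z.u j) - HarmonicVar.atPhase (w * ((j : ℕ) - N)) z.h := rfl

/-- Deviation of the predicted terminal state from the harmonic reference, whose phase at the
end of the horizon is `0`. -/
noncomputable def terminalDeviation : HMPCDecision n m N →ₗ[ℝ] (Fin n → ℝ) :=
  xL (Fin.last N) - (HarmonicVar.xeL + HarmonicVar.xcL).comp hL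

theorem terminalDeviation_apply (z : HMPCDecision n m N) :
    terminalDeviation z = z.x (Fin.last N) - (z.h.xe + z.h.xc) := rfl

/-- The decision that stays at the point `(x, u)` and has it as its constant reference. -/
def const (x : Fin n → ℝ) (u : Fin m → ℝ) : HMPCDecision n m N where
  x _ := x
  u _ := u
  h := HarmonicVar.const x u

@[simp] theorem deviation_const (w : ℝ) (j : Fin N) (x : Fin n → ℝ) (u : Fin m → ℝ) :
    deviation w j (const x u) = 0 := by
  simp [deviation_apply, const]

@[simp] theorem terminalDeviation_const (x : Fin n → ℝ) (u : Fin m → ℝ) :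
    terminalDeviation (const x u : HMPCDecision n m N) = 0 := by
  simp [terminalDeviation_apply, const, HarmonicVar.const]

end HMPCDecision

/-! ### The costs as quadratic forms -/

namespace HMPCData

variable {n m p N : ℕ} (D : HMPCData n m p)

/-- The form `(x, u) ↦ ‖x‖²_Q + ‖u‖²_R`. -/
noncomputable def stageForm : QuadraticForm ℝ ((Fin n → ℝ) × (Fin m → ℝ)) :=
  (wnormForm D.Q).prod (wnormForm D.R)

theorem stageForm_apply (v : (Fin n → ℝ) × (Fin m → ℝ)) :
    D.stageForm v = wnormSq D.Q v.1 + wnormSq D.R v.2 := by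
  simp [stageForm]

/-- The form `(x, u) ↦ ‖x‖²_{T_e} + ‖u‖²_{S_e}`. -/
noncomputable def steadyForm : QuadraticForm ℝ ((Fin n → ℝ) × (Fin m → ℝ)) :=
  (wnormForm D.Te).prod (wnormForm D.Se)

theorem steadyCost_eq (xr : Fin n → ℝ) (ur : Fin m → ℝ) (z : (Fin n → ℝ) × (Fin m → ℝ)) :
    D.steadyCost xr ur z = D.steadyForm (z - (xr, ur)) := by
  simp [steadyForm, steadyCost]

/-- The offset cost of a harmonic reference relative to the zero reference. -/
noncomputable def offsetForm : QuadraticForm ℝ (HarmonicVar n m) :=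
  (wnormForm D.Te).comp HarmonicVar.xeL + (wnormForm D.Se).comp HarmonicVar.ueL
    + (wnormForm D.Th).comp HarmonicVar.xsL + (wnormForm D.Th).comp HarmonicVar.xcL
    + (wnormForm D.Sh).comp HarmonicVar.usL + (wnormForm D.Sh).comp HarmonicVar.ucL

theorem offsetCost_eq (xr : Fin n → ℝ) (ur : Fin m → ℝ) (h : HarmonicVar n m) :
    D.offsetCost xr ur h = D.offsetForm (h - HarmonicVar.const xr ur) := by
  simp [offsetForm, offsetCost, HarmonicVar.const]

/-- The sum of the stage costs as a quadratic form of the decision. -/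
noncomputable def trackingForm (N : ℕ) : QuadraticForm ℝ (HMPCDecision n m N) :=
  ∑ j : Fin N, D.stageForm.comp (HMPCDecision.deviation D.w j)

theorem trackingForm_apply (z : HMPCDecision n m N) :
    D.trackingForm N z = ∑ j : Fin N, D.stageForm (HMPCDecision.deviation D.w j z) := by
  simp [trackingForm]

theorem stageCost_eq (z : HMPCDecision n m N) : D.stageCost N z = D.trackingForm N z := by
  rw [trackingForm_apply]
  simp only [stageForm_apply]
  rfl

/-- The total cost as a quadratic form of the decision. The terminal term, which vanishes under
the terminal constraint, makes the form definite. -/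
noncomputable def costForm (N : ℕ) : QuadraticForm ℝ (HMPCDecision n m N) :=
  D.trackingForm N + (wnormForm D.Q).comp HMPCDecision.terminalDeviation
    + D.offsetForm.comp HMPCDecision.hL

theorem costForm_apply (z : HMPCDecision n m N) : D.costForm N z =
    D.trackingForm N z + wnormSq D.Q (HMPCDecision.terminalDeviation z) + D.offsetForm z.h := by
  simp [costForm]

theorem trackingForm_sub_const (z : HMPCDecision n m N) (x : Fin n → ℝ) (u : Fin m → ℝ) :
    D.trackingForm N (z - HMPCDecision.const x u) = D.trackingForm N z := by
  simp [trackingForm_apply]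

theorem totalCost_eq (xr : Fin n → ℝ) (ur : Fin m → ℝ) {z : HMPCDecision n m N}
    (hz : z.x (Fin.last N) = z.h.xe + z.h.xc) :
    D.totalCost N xr ur z = D.costForm N (z - HMPCDecision.const xr ur) := by
  have ht : HMPCDecision.terminalDeviation (z - HMPCDecision.const xr ur) = 0 := by
    rw [map_sub, HMPCDecision.terminalDeviation_const, HMPCDecision.terminalDeviation_apply, hz,
      sub_self, sub_zero]
  rw [totalCost, stageCost_eq, offsetCost_eq, costForm_apply, trackingForm_sub_const, ht]
  simp [wnormSq, HMPCDecision.const]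

theorem offsetCost_rotate (xr : Fin n → ℝ) (ur : Fin m → ℝ) (h : HarmonicVar n m) (w : ℝ) :
    D.offsetCost xr ur (h.rotate w) = D.offsetCost xr ur h := by
  have h1 := wnormSq_rotate D.Th h.xs h.xc w
  have h2 := wnormSq_rotate D.Sh h.us h.uc w
  simp only [offsetCost, HarmonicVar.rotate]
  linarith

variable {D}

theorem Assumptions.stageForm_posDef (hD : D.Assumptions) : D.stageForm.PosDef :=
  (wnormForm_posDef hD.Q_posDef).prod (wnormForm_posDef hD.R_posDef)

theorem Assumptions.steadyForm_posDef (hD : D.Assumptions) : D.steadyForm.PosDef :=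
  (wnormForm_posDef hD.Te_posDef).prod (wnormForm_posDef hD.Se_posDef)

theorem Assumptions.offsetForm_posDef (hD : D.Assumptions) : D.offsetForm.PosDef := by
  have h1 := wnormSq_nonneg hD.Te_posDef
  have h2 := wnormSq_nonneg hD.Se_posDef
  have h3 := wnormSq_nonneg hD.Th_posDef
  have h4 := wnormSq_nonneg hD.Sh_posDef
  have e : ∀ h : HarmonicVar n m, D.offsetForm h = wnormSq D.Te h.xe + wnormSq D.Se h.ue
      + wnormSq D.Th h.xs + wnormSq D.Th h.xc + wnormSq D.Sh h.us + wnormSq D.Sh h.uc := by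
    intro h; simp [offsetForm]
  refine QuadraticMap.posDef_of_nonneg (fun h => ?_) (fun h hh => ?_)
  · rw [e]
    have := h1 h.xe; have := h2 h.ue; have := h3 h.xs; have := h3 h.xc
    have := h4 h.us; have := h4 h.uc
    positivity
  · rw [e] at hh
    have a1 := h1 h.xe; have a2 := h2 h.ue; have a3 := h3 h.xs; have a4 := h3 h.xc
    have a5 := h4 h.us; have a6 := h4 h.uc
    ext1
    · exact (wnormSq_eq_zero hD.Te_posDef).1 (by linarith)
    · exact (wnormSq_eq_zero hD.Th_posDef).1 (by linarith)
    · exact (wnormSq_eq_zero hD.Th_posDef).1 (by linarith)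
    · exact (wnormSq_eq_zero hD.Se_posDef).1 (by linarith)
    · exact (wnormSq_eq_zero hD.Sh_posDef).1 (by linarith)
    · exact (wnormSq_eq_zero hD.Sh_posDef).1 (by linarith)

theorem Assumptions.trackingForm_nonneg (hD : D.Assumptions) (z : HMPCDecision n m N) :
    0 ≤ D.trackingForm N z := by
  rw [trackingForm_apply]
  exact Finset.sum_nonneg fun j _ => hD.stageForm_posDef.nonneg _

theorem Assumptions.stageForm_deviation_le (hD : D.Assumptions) (z : HMPCDecision n m N)
    (j : Fin N) : D.stageForm (HMPCDecision.deviation D.w j z) ≤ D.trackingForm N z := by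
  rw [trackingForm_apply]
  exact Finset.single_le_sum (f := fun j => D.stageForm (HMPCDecision.deviation D.w j z))
    (fun i _ => hD.stageForm_posDef.nonneg _) (Finset.mem_univ j)

theorem Assumptions.costForm_posDef (hD : D.Assumptions) : (D.costForm N).PosDef := by
  have h1 := hD.trackingForm_nonneg (N := N)
  have h2 : ∀ z : HMPCDecision n m N, _ := fun z =>
    wnormSq_nonneg hD.Q_posDef (HMPCDecision.terminalDeviation z)
  have h3 : ∀ z : HMPCDecision n m N, _ := fun z => hD.offsetForm_posDef.nonneg z.h
  refine QuadraticMap.posDef_of_nonneg (fun z => ?_) (fun z hz => ?_)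
  · rw [costForm_apply]; have := h1 z; have := h2 z; have := h3 z; positivity
  · rw [costForm_apply] at hz
    have a1 := h1 z; have a2 := h2 z; have a3 := h3 z
    have hh : z.h = 0 := hD.offsetForm_posDef.anisotropic.eq_zero_iff.1 (by linarith)
    have ht : HMPCDecision.terminalDeviation z = 0 := (wnormSq_eq_zero hD.Q_posDef).1 (by linarith)
    rw [← HMPCDecision.hL_apply] at hh
    have hxu : ∀ j : Fin N, HMPCDecision.xuL j z = 0 := by
      intro j
      have h := hD.stageForm_deviation_le z j
      have h0 := hD.stageForm_posDef.nonneg (HMPCDecision.deviation D.w j z)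
      have h' : HMPCDecision.deviation D.w j z = 0 :=
        hD.stageForm_posDef.anisotropic.eq_zero_iff.1 (by linarith)
      simpa [HMPCDecision.deviation, hh] using h'
    have hx : HMPCDecision.xL (Fin.last N) z = 0 := by
      rwa [HMPCDecision.terminalDeviation, LinearMap.sub_apply, LinearMap.comp_apply, hh, map_zero,
        sub_zero] at ht
    ext1
    · funext j
      refine Fin.lastCases hx (fun j => ?_) j
      exact congrArg Prod.fst (hxu j)
    · funext j
      exact congrArg Prod.snd (hxu j)
    · exact hh

end HMPCData

/-! ### The feasible sets -/

namespace HMPCData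

variable {n m p N : ℕ} (D : HMPCData n m p)

/-- The successor state `A x + B u` as a linear map of `(x, u)`. -/
def stepL : (Fin n → ℝ) × (Fin m → ℝ) →ₗ[ℝ] (Fin n → ℝ) :=
  D.A.mulVecLin.coprod D.B.mulVecLin

/-- The output `E x + F u` as a linear map of `(x, u)`. -/
def outputL : (Fin n → ℝ) × (Fin m → ℝ) →ₗ[ℝ] (Fin p → ℝ) :=
  D.E.mulVecLin.coprod D.F.mulVecLin

theorem stepL_apply (z : (Fin n → ℝ) × (Fin m → ℝ)) :
    D.stepL z = D.A *ᵥ z.1 + D.B *ᵥ z.2 := by simp [stepL]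

theorem outputL_apply (z : (Fin n → ℝ) × (Fin m → ℝ)) :
    D.outputL z = D.E *ᵥ z.1 + D.F *ᵥ z.2 := by simp [outputL]

theorem mem_constraintSet_iff {z : (Fin n → ℝ) × (Fin m → ℝ)} :
    z ∈ D.constraintSet ↔ D.outputL z ∈ Set.Icc D.ylo D.yhi := by
  rw [outputL_apply]; rfl

theorem mem_tightenedSteadyStates_iff {z : (Fin n → ℝ) × (Fin m → ℝ)} :
    z ∈ D.tightenedSteadyStates ↔ z.1 = D.stepL z ∧
      D.outputL z ∈ Set.Icc (D.ylo + D.eps) (D.yhi - D.eps) := by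
  rw [outputL_apply, stepL_apply]; rfl

theorem outputL_atPhase (θ : ℝ) (h : HarmonicVar n m) (i : Fin p) :
    D.outputL (HarmonicVar.atPhase θ h) i = D.output h.xe h.ue i
      + (Real.sin θ * D.output h.xs h.us i + Real.cos θ * D.output h.xc h.uc i) := by
  simp only [outputL_apply, HarmonicVar.atPhase_apply, output, mulVec_add, mulVec_smul,
    Pi.add_apply, Pi.smul_apply, smul_eq_mul]
  ring

/-- The constraints on a harmonic reference say that at every phase it follows the dynamics and
satisfies the tightened constraints: the cone constraints are the maximum over the phases. -/
theorem mem_harmonicSet_iff {h : HarmonicVar n m} : h ∈ D.harmonicSet ↔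
    (∀ θ, (HarmonicVar.atPhase (θ + D.w) h).1 = D.stepL (HarmonicVar.atPhase θ h)) ∧
    ∀ θ, D.outputL (HarmonicVar.atPhase θ h) ∈ Set.Icc (D.ylo + D.eps) (D.yhi - D.eps) := by
  have hstep : ∀ θ, D.stepL (HarmonicVar.atPhase θ h) = (D.A *ᵥ h.xe + D.B *ᵥ h.ue)
      + Real.sin θ • (D.A *ᵥ h.xs + D.B *ᵥ h.us) + Real.cos θ • (D.A *ᵥ h.xc + D.B *ᵥ h.uc) := by
    intro θ
    simp only [stepL_apply, HarmonicVar.atPhase_apply, mulVec_add, mulVec_smul]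
    module
  have hadv : ∀ θ, (HarmonicVar.atPhase (θ + D.w) h).1 = h.xe
      + Real.sin θ • (Real.cos D.w • h.xs - Real.sin D.w • h.xc)
      + Real.cos θ • (Real.sin D.w • h.xs + Real.cos D.w • h.xc) := by
    intro θ
    simp only [HarmonicVar.atPhase_apply, Real.sin_add, Real.cos_add]
    module
  have hdyn : (∀ θ, (HarmonicVar.atPhase (θ + D.w) h).1 = D.stepL (HarmonicVar.atPhase θ h)) ↔
      h.xe = D.A *ᵥ h.xe + D.B *ᵥ h.ue ∧
      Real.cos D.w • h.xs - Real.sin D.w • h.xc = D.A *ᵥ h.xs + D.B *ᵥ h.us ∧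
      Real.sin D.w • h.xs + Real.cos D.w • h.xc = D.A *ᵥ h.xc + D.B *ᵥ h.uc := by
    simp only [hstep, hadv]
    constructor
    · intro H
      -- the phases `0`, `π` and `π / 2` isolate the three coefficients
      have e0 := H 0
      have e1 := H Real.pi
      have e2 := H (Real.pi / 2)
      simp only [Real.sin_zero, Real.cos_zero, Real.sin_pi, Real.cos_pi, Real.sin_pi_div_two,
        Real.cos_pi_div_two, zero_smul, one_smul, neg_smul, add_zero] at e0 e1 e2
      have he : h.xe = D.A *ᵥ h.xe + D.B *ᵥ h.ue := by
        funext i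
        have a := congrFun e0 i
        have b := congrFun e1 i
        simp only [Pi.add_apply, Pi.neg_apply] at a b ⊢
        linarith
      rw [← he] at e0 e2
      exact ⟨he, add_left_cancel e2, add_left_cancel e0⟩
    · rintro ⟨a, b, c⟩ θ
      rw [b, c, ← a]
  have hcone : (∀ θ, D.outputL (HarmonicVar.atPhase θ h) ∈
        Set.Icc (D.ylo + D.eps) (D.yhi - D.eps)) ↔
      (∀ i, Real.sqrt ((D.output h.xs h.us i) ^ 2 + (D.output h.xc h.uc i) ^ 2)
        ≤ D.output h.xe h.ue i - D.ylo i - D.eps i) ∧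
      (∀ i, Real.sqrt ((D.output h.xs h.us i) ^ 2 + (D.output h.xc h.uc i) ^ 2)
        ≤ D.yhi i - D.eps i - D.output h.xe h.ue i) := by
    simp only [sqrt_sq_add_sq_le_iff, Set.mem_Icc, Pi.le_def, outputL_atPhase, Pi.add_apply,
      Pi.sub_apply]
    constructor
    · intro H
      refine ⟨fun i θ => ?_, fun i θ => ?_⟩
      · have := (H (θ + Real.pi)).1 i
        rw [Real.sin_add_pi, Real.cos_add_pi] at this
        linarith
      · have := (H θ).2 i
        linarith
    · rintro ⟨H1, H2⟩ θ
      refine ⟨fun i => ?_, fun i => ?_⟩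
      · have := H1 i (θ + Real.pi)
        rw [Real.sin_add_pi, Real.cos_add_pi] at this
        linarith
      · have := H2 i θ
        linarith
  rw [hdyn, hcone]
  simp only [harmonicSet, Set.mem_ofPred_eq, and_assoc]

theorem rotate_mem_harmonicSet {h : HarmonicVar n m} (hh : h ∈ D.harmonicSet) :
    h.rotate D.w ∈ D.harmonicSet := by
  rw [mem_harmonicSet_iff] at hh ⊢
  simp only [HarmonicVar.atPhase_rotate]
  exact ⟨fun θ => hh.1 _, fun θ => hh.2 _⟩

theorem const_mem_harmonicSet_iff {x : Fin n → ℝ} {u : Fin m → ℝ} :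
    HarmonicVar.const x u ∈ D.harmonicSet ↔ (x, u) ∈ D.tightenedSteadyStates := by
  simp [mem_harmonicSet_iff, mem_tightenedSteadyStates_iff]

/-- The constant part of an admissible harmonic reference is an admissible steady state: it is
the average of two opposite phases. -/
theorem steady_of_mem_harmonicSet {h : HarmonicVar n m} (hh : h ∈ D.harmonicSet) :
    (h.xe, h.ue) ∈ D.tightenedSteadyStates := by
  obtain ⟨h1, -, -, h4, h5⟩ := hh
  refine ⟨h1, fun i => ?_, fun i => ?_⟩
  · have := (Real.sqrt_nonneg _).trans (h4 i)
    simp only [output, Pi.add_apply] at this ⊢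
    linarith
  · have := (Real.sqrt_nonneg _).trans (h5 i)
    simp only [output, Pi.add_apply, Pi.sub_apply] at this ⊢
    linarith

/-- Defect of a harmonic reference in the dynamics at the phase `θ`. -/
noncomputable def harmonicDefect (θ : ℝ) : HarmonicVar n m →ₗ[ℝ] (Fin n → ℝ) :=
  (LinearMap.fst ℝ (Fin n → ℝ) (Fin m → ℝ)).comp (HarmonicVar.atPhase (θ + D.w))
    - D.stepL.comp (HarmonicVar.atPhase θ)

theorem harmonicSet_eq : D.harmonicSet = (⋂ θ : ℝ, D.harmonicDefect θ ⁻¹' {0}) ∩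
    ⋂ θ : ℝ, (D.outputL.comp (HarmonicVar.atPhase θ)) ⁻¹'
      Set.Icc (D.ylo + D.eps) (D.yhi - D.eps) := by
  ext h
  simp [mem_harmonicSet_iff, harmonicDefect, sub_eq_zero]

theorem convex_harmonicSet : Convex ℝ D.harmonicSet := by
  rw [harmonicSet_eq]
  exact (convex_iInter fun θ => (convex_singleton 0).linear_preimage _).inter
    (convex_iInter fun θ => (convex_Icc _ _).linear_preimage _)

theorem isClosed_harmonicSet : IsClosed D.harmonicSet := by
  rw [harmonicSet_eq]
  exact (isClosed_iInter fun θ =>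
      isClosed_singleton.preimage (LinearMap.continuous_of_finiteDimensional _)).inter
    (isClosed_iInter fun θ =>
      isClosed_Icc.preimage (LinearMap.continuous_of_finiteDimensional _))

theorem tightenedSteadyStates_eq : D.tightenedSteadyStates =
    (LinearMap.fst ℝ (Fin n → ℝ) (Fin m → ℝ) - D.stepL) ⁻¹' {0} ∩
      D.outputL ⁻¹' Set.Icc (D.ylo + D.eps) (D.yhi - D.eps) := by
  ext h
  simp [mem_tightenedSteadyStates_iff, sub_eq_zero]

theorem convex_tightenedSteadyStates : Convex ℝ D.tightenedSteadyStates := by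
  rw [tightenedSteadyStates_eq]
  exact ((convex_singleton 0).linear_preimage _).inter ((convex_Icc _ _).linear_preimage _)

theorem isClosed_tightenedSteadyStates : IsClosed D.tightenedSteadyStates := by
  rw [tightenedSteadyStates_eq]
  exact (isClosed_singleton.preimage (LinearMap.continuous_of_finiteDimensional _)).inter
    (isClosed_Icc.preimage (LinearMap.continuous_of_finiteDimensional _))

theorem mem_feasibleSet_iff {x : Fin n → ℝ} {z : HMPCDecision n m N} : z ∈ D.feasibleSet N x ↔
    (∀ j : Fin N, z.x j.succ = D.stepL (z.x j.castSucc, z.u j)) ∧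
    (∀ j : Fin N, D.outputL (z.x j.castSucc, z.u j) ∈ Set.Icc D.ylo D.yhi) ∧
    z.x 0 = x ∧ z.x (Fin.last N) = z.h.xe + z.h.xc ∧ z.h ∈ D.harmonicSet := by
  simp only [feasibleSet, Set.mem_ofPred_eq, stepL_apply, mem_constraintSet_iff]

/-- Defect of the predicted trajectory in the dynamics at step `j`. -/
noncomputable def dynamicsDefect (j : Fin N) : HMPCDecision n m N →ₗ[ℝ] (Fin n → ℝ) :=
  HMPCDecision.xL j.succ - D.stepL.comp (HMPCDecision.xuL j)

theorem feasibleSet_eq (x : Fin n → ℝ) : D.feasibleSet N x =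
    (⋂ j : Fin N, D.dynamicsDefect j ⁻¹' {0}) ∩
    ((⋂ j : Fin N, (D.outputL.comp (HMPCDecision.xuL j)) ⁻¹' Set.Icc D.ylo D.yhi) ∩
    ((HMPCDecision.xL 0) ⁻¹' {x} ∩
      (HMPCDecision.terminalDeviation ⁻¹' {0} ∩ HMPCDecision.hL ⁻¹' D.harmonicSet))) := by
  ext z
  simp [mem_feasibleSet_iff, dynamicsDefect, sub_eq_zero, HMPCDecision.terminalDeviation_apply]

theorem convex_feasibleSet (x : Fin n → ℝ) : Convex ℝ (D.feasibleSet N x) := by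
  rw [feasibleSet_eq]
  exact (convex_iInter fun j => (convex_singleton 0).linear_preimage _).inter
    ((convex_iInter fun j => (convex_Icc _ _).linear_preimage _).inter
    (((convex_singleton x).linear_preimage _).inter
    (((convex_singleton 0).linear_preimage _).inter (D.convex_harmonicSet.linear_preimage _))))

theorem isClosed_feasibleSet (x : Fin n → ℝ) : IsClosed (D.feasibleSet N x) := by
  rw [feasibleSet_eq]
  exact (isClosed_iInter fun j =>
      isClosed_singleton.preimage (LinearMap.continuous_of_finiteDimensional _)).inter
    ((isClosed_iInter fun j =>
      isClosed_Icc.preimage (LinearMap.continuous_of_finiteDimensional _)).inter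
    ((isClosed_singleton.preimage (LinearMap.continuous_of_finiteDimensional _)).inter
    ((isClosed_singleton.preimage (LinearMap.continuous_of_finiteDimensional _)).inter
    (D.isClosed_harmonicSet.preimage (LinearMap.continuous_of_finiteDimensional _)))))

end HMPCData

/-! ### Controllability -/

section Controllability

variable {n m : ℕ} (A : Matrix (Fin n) (Fin n) ℝ) (B : Matrix (Fin n) (Fin m) ℝ)

theorem stateAfter_zero_eq_sum (u : ℕ → Fin m → ℝ) (t : ℕ) :
    stateAfter A B 0 u t = ∑ i ∈ Finset.range t, (A ^ i * B) *ᵥ u (t - 1 - i) := by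
  induction t with
  | zero => rfl
  | succ t ih =>
    rw [stateAfter, ih, Finset.sum_range_succ', Matrix.mulVec_sum]
    simp only [Matrix.mulVec_mulVec, pow_succ', Matrix.mul_assoc, pow_zero, Matrix.one_mul,
      Nat.add_sub_cancel, Nat.sub_zero]
    congr 1
    refine Finset.sum_congr rfl fun i _ => ?_
    rw [show t - 1 - i = t - (i + 1) by omega]

theorem stateAfter_eq_add (x : Fin n → ℝ) (u : ℕ → Fin m → ℝ) (t : ℕ) :
    stateAfter A B x u t = (A ^ t) *ᵥ x + stateAfter A B 0 u t := by
  induction t with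
  | zero => simp [stateAfter]
  | succ t ih =>
    simp only [stateAfter]
    rw [ih, mulVec_add, mulVec_mulVec, pow_succ', add_assoc]

theorem controllabilityMatrix_mulVec (t : ℕ) (v : Fin t × Fin m → ℝ) :
    controllabilityMatrix A B t *ᵥ v =
      ∑ i : Fin t, (A ^ (i : ℕ) * B) *ᵥ fun k => v (i, k) := by
  funext r
  simp [controllabilityMatrix, mulVec, dotProduct, Fintype.sum_prod_type]

/-- The states reachable from the origin in `t` steps. -/
noncomputable def reachableSubmodule (t : ℕ) : Submodule ℝ (Fin n → ℝ) :=
  LinearMap.range (controllabilityMatrix A B t).mulVecLin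

theorem mem_reachableSubmodule_iff {t : ℕ} {x : Fin n → ℝ} :
    x ∈ reachableSubmodule A B t ↔ ∃ u, stateAfter A B 0 u t = x := by
  simp only [reachableSubmodule, LinearMap.mem_range, mulVecLin_apply,
    controllabilityMatrix_mulVec, stateAfter_zero_eq_sum]
  constructor
  · rintro ⟨v, rfl⟩
    refine ⟨fun s => if h : t - 1 - s < t then fun k => v (⟨t - 1 - s, h⟩, k) else 0, ?_⟩
    rw [Finset.sum_range]
    refine Finset.sum_congr rfl fun i _ => ?_
    have hi : t - 1 - (t - 1 - (i : ℕ)) = i := by omega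
    simp only [hi, i.2, dite_true]
  · rintro ⟨u, rfl⟩
    exact ⟨fun q => u (t - 1 - q.1) q.2, by rw [Finset.sum_range]⟩

theorem reachableSubmodule_mono : Monotone (reachableSubmodule A B) := by
  refine monotone_nat_of_le_succ fun t x hx => ?_
  rw [mem_reachableSubmodule_iff] at hx ⊢
  obtain ⟨u, rfl⟩ := hx
  -- idle for one step first
  let u' : ℕ → Fin m → ℝ := fun s => Nat.casesOn s 0 u
  have h : ∀ s, stateAfter A B 0 u' (s + 1) = stateAfter A B 0 u s := by
    intro s
    induction s with
    | zero => simp [stateAfter, u']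
    | succ s ih => rw [stateAfter, ih]; rfl
  exact ⟨u', h t⟩

theorem reachableSubmodule_eq_top_iff (t : ℕ) :
    reachableSubmodule A B t = ⊤ ↔ (controllabilityMatrix A B t).rank = n := by
  rw [Matrix.rank]
  constructor
  · intro h
    rw [reachableSubmodule] at h
    rw [h, finrank_top, Module.finrank_fin_fun]
  · intro h
    exact Submodule.eq_top_of_finrank_eq (by rw [Module.finrank_fin_fun]; exact h)

variable {A B}

theorem IsControllable.reachableSubmodule_eq_top (h : IsControllable A B) {N : ℕ}
    (hN : controllabilityIndex A B ≤ N) : reachableSubmodule A B N = ⊤ := by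
  have hne : {j : ℕ | 0 < j ∧ (controllabilityMatrix A B j).rank = n}.Nonempty := by
    obtain ⟨T, hT⟩ := monotone_stabilizes_iff_noetherian.2 inferInstance
      (⟨_, reachableSubmodule_mono A B⟩ : ℕ →o Submodule ℝ (Fin n → ℝ))
    refine ⟨T + 1, T.succ_pos, (reachableSubmodule_eq_top_iff A B _).1 ?_⟩
    rw [eq_top_iff]
    intro x _
    obtain ⟨t, u, hu⟩ := h 0 x
    have hx : x ∈ reachableSubmodule A B (max t T) :=
      reachableSubmodule_mono A B (le_max_left _ _) ((mem_reachableSubmodule_iff A B).2 ⟨u, hu⟩)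
    have e : reachableSubmodule A B T = reachableSubmodule A B (max t T) := hT _ (le_max_right _ _)
    rw [← e] at hx
    exact reachableSubmodule_mono A B (Nat.le_succ T) hx
  have hi := (reachableSubmodule_eq_top_iff A B _).2 (Nat.sInf_mem hne).2
  exact top_le_iff.1 (hi ▸ reachableSubmodule_mono A B hN)

/-- The trajectories of length `N` of the system. -/
def trajectorySubmodule (A : Matrix (Fin n) (Fin n) ℝ) (B : Matrix (Fin n) (Fin m) ℝ) (N : ℕ) :
    Submodule ℝ ((Fin (N + 1) → Fin n → ℝ) × (Fin N → Fin m → ℝ)) where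
  carrier := {v | ∀ j : Fin N, v.1 j.succ = A *ᵥ v.1 j.castSucc + B *ᵥ v.2 j}
  add_mem' {a b} ha hb j := by
    have h1 := ha j
    have h2 := hb j
    simp only [Prod.fst_add, Prod.snd_add, Pi.add_apply, mulVec_add, h1, h2]
    abel
  zero_mem' j := by simp
  smul_mem' c a ha j := by
    have h1 := ha j
    simp only [Prod.smul_fst, Prod.smul_snd, Pi.smul_apply, mulVec_smul, h1, smul_add]

/-- In at least as many steps as the controllability index, a trajectory with prescribed end
points can be chosen linearly in the end points. -/
theorem IsControllable.exists_steering (h : IsControllable A B) {N : ℕ}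
    (hN : controllabilityIndex A B ≤ N) :
    ∃ S : (Fin n → ℝ) × (Fin n → ℝ) →ₗ[ℝ] (Fin (N + 1) → Fin n → ℝ) × (Fin N → Fin m → ℝ),
      ∀ v, (∀ j : Fin N, (S v).1 j.succ = A *ᵥ (S v).1 j.castSucc + B *ᵥ (S v).2 j) ∧
        (S v).1 0 = v.1 ∧ (S v).1 (Fin.last N) = v.2 := by
  let T := trajectorySubmodule A B N
  let ends : T →ₗ[ℝ] (Fin n → ℝ) × (Fin n → ℝ) :=
    ((LinearMap.proj (R := ℝ) (φ := fun _ : Fin (N + 1) => Fin n → ℝ) 0).prod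
      (LinearMap.proj (Fin.last N))).comp ((LinearMap.fst ℝ _ _).comp T.subtype)
  have hsurj : LinearMap.range ends = ⊤ := by
    rw [LinearMap.range_eq_top]
    rintro ⟨a, b⟩
    have hb : b - (A ^ N) *ᵥ a ∈ reachableSubmodule A B N := by
      rw [h.reachableSubmodule_eq_top hN]; trivial
    obtain ⟨u, hu⟩ := (mem_reachableSubmodule_iff A B).1 hb
    refine ⟨⟨(fun j => stateAfter A B a u j, fun j => u j), fun j => rfl⟩, ?_⟩
    refine Prod.ext rfl ?_
    change stateAfter A B a u N = b
    rw [stateAfter_eq_add, hu]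
    abel
  obtain ⟨S, hS⟩ := ends.exists_rightInverse_of_surjective hsurj
  refine ⟨T.subtype.comp S, fun v => ⟨(S v).2, ?_, ?_⟩⟩
  · exact congrArg Prod.fst (LinearMap.congr_fun hS v)
  · exact congrArg Prod.snd (LinearMap.congr_fun hS v)

end Controllability

/-! ### Optimal solutions -/

namespace HMPCData

variable {n m p N : ℕ} {D : HMPCData n m p}

theorem totalCost_eq_add (xr : Fin n → ℝ) (ur : Fin m → ℝ) (z : HMPCDecision n m N) :
    D.totalCost N xr ur z = D.trackingForm N z + D.offsetCost xr ur z.h := by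
  rw [totalCost, stageCost_eq]

theorem totalCost_eq_of_mem {x : Fin n → ℝ} (xr : Fin n → ℝ) (ur : Fin m → ℝ)
    {z : HMPCDecision n m N} (hz : z ∈ D.feasibleSet N x) :
    D.totalCost N xr ur z = D.costForm N (z - HMPCDecision.const xr ur) :=
  D.totalCost_eq xr ur hz.2.2.2.1

theorem totalCost_add_costForm_sub_le {x xr : Fin n → ℝ} {ur : Fin m → ℝ}
    {z y : HMPCDecision n m N} (hz : z ∈ D.feasibleSet N x)
    (hmin : IsMinOn (D.totalCost N xr ur) (D.feasibleSet N x) z) (hy : y ∈ D.feasibleSet N x) :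
    D.totalCost N xr ur z + D.costForm N (y - z) ≤ D.totalCost N xr ur y := by
  rw [totalCost_eq_of_mem xr ur hz, totalCost_eq_of_mem xr ur hy]
  refine QuadraticMap.add_apply_sub_le_of_isMinOn _ (D.convex_feasibleSet x) hz ?_ hy
  intro v hv
  have : D.totalCost N xr ur z ≤ D.totalCost N xr ur v := hmin hv
  rwa [totalCost_eq_of_mem xr ur hz, totalCost_eq_of_mem xr ur hv] at this

theorem Assumptions.eq_of_isMinOn_totalCost (hD : D.Assumptions) {x xr : Fin n → ℝ}
    {ur : Fin m → ℝ} {z y : HMPCDecision n m N} (hz : z ∈ D.feasibleSet N x)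
    (hmin : IsMinOn (D.totalCost N xr ur) (D.feasibleSet N x) z) (hy : y ∈ D.feasibleSet N x)
    (hymin : IsMinOn (D.totalCost N xr ur) (D.feasibleSet N x) y) : y = z := by
  have h1 := totalCost_add_costForm_sub_le hz hmin hy
  have h2 : D.totalCost N xr ur y ≤ D.totalCost N xr ur z := hymin hz
  have h3 := hD.costForm_posDef.nonneg (y - z)
  exact sub_eq_zero.1 (hD.costForm_posDef.anisotropic.eq_zero_iff.1 (by linarith))

theorem Assumptions.exists_isUniqueMinimizer_totalCost (hD : D.Assumptions) {x : Fin n → ℝ}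
    (xr : Fin n → ℝ) (ur : Fin m → ℝ) (hx : x ∈ D.feasibilityRegion N) :
    ∃ z : HMPCDecision n m N, IsUniqueMinimizer (D.totalCost N xr ur) (D.feasibleSet N x) z := by
  obtain ⟨z, hz, hmin⟩ := hD.costForm_posDef.exists_isMinOn (D.isClosed_feasibleSet x) hx
    (HMPCDecision.const xr ur)
  have hmin' : IsMinOn (D.totalCost N xr ur) (D.feasibleSet N x) z := by
    intro v hv
    change D.totalCost N xr ur z ≤ D.totalCost N xr ur v
    rw [totalCost_eq_of_mem xr ur hz, totalCost_eq_of_mem xr ur hv]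
    exact hmin hv
  exact ⟨z, hz, hmin', fun y hy hymin => hD.eq_of_isMinOn_totalCost hz hmin' hy hymin⟩

theorem Assumptions.controlLaw_eq [NeZero N] (hD : D.Assumptions) {x xr : Fin n → ℝ}
    {ur : Fin m → ℝ} {z : HMPCDecision n m N} (hz : z ∈ D.feasibleSet N x)
    (hmin : IsMinOn (D.totalCost N xr ur) (D.feasibleSet N x) z) :
    D.controlLaw N xr ur x = z.u 0 := by
  have hex : ∃ z ∈ D.feasibleSet N x, IsMinOn (D.totalCost N xr ur) (D.feasibleSet N x) z :=
    ⟨z, hz, hmin⟩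
  rw [controlLaw, dif_pos hex]
  rw [hD.eq_of_isMinOn_totalCost hz hmin hex.choose_spec.1 hex.choose_spec.2]

/-! ### The optimal artificial harmonic reference -/

theorem offsetCost_const (xr xe : Fin n → ℝ) (ur ue : Fin m → ℝ) :
    D.offsetCost xr ur (HarmonicVar.const xe ue) = D.steadyCost xr ur (xe, ue) := by
  simp [offsetCost, steadyCost, HarmonicVar.const, wnormSq]

theorem Assumptions.steadyCost_le_offsetCost (hD : D.Assumptions) (xr : Fin n → ℝ)
    (ur : Fin m → ℝ) (h : HarmonicVar n m) :
    D.steadyCost xr ur (h.xe, h.ue) ≤ D.offsetCost xr ur h := by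
  have := wnormSq_nonneg hD.Th_posDef h.xs
  have := wnormSq_nonneg hD.Th_posDef h.xc
  have := wnormSq_nonneg hD.Sh_posDef h.us
  have := wnormSq_nonneg hD.Sh_posDef h.uc
  simp only [steadyCost, offsetCost]
  linarith

theorem offsetCost_add_offsetForm_sub_le {xr : Fin n → ℝ} {ur : Fin m → ℝ}
    {ho h : HarmonicVar n m} (hho : ho ∈ D.harmonicSet)
    (hmin : IsMinOn (D.offsetCost xr ur) D.harmonicSet ho) (hh : h ∈ D.harmonicSet) :
    D.offsetCost xr ur ho + D.offsetForm (h - ho) ≤ D.offsetCost xr ur h := by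
  rw [offsetCost_eq, offsetCost_eq]
  refine QuadraticMap.add_apply_sub_le_of_isMinOn _ D.convex_harmonicSet hho ?_ hh
  intro v hv
  have : D.offsetCost xr ur ho ≤ D.offsetCost xr ur v := hmin hv
  rwa [offsetCost_eq, offsetCost_eq] at this

/-- The oscillating part of a harmonic reference only adds cost, so that the optimal harmonic
reference is the optimal admissible steady state. -/
theorem Assumptions.exists_optimal_reference (hD : D.Assumptions) (xr : Fin n → ℝ)
    (ur : Fin m → ℝ) (hne : D.harmonicSet.Nonempty) :
    ∃ (xo : Fin n → ℝ) (uo : Fin m → ℝ),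
      IsUniqueMinimizer (D.offsetCost xr ur) D.harmonicSet (HarmonicVar.const xo uo) ∧
      IsUniqueMinimizer (D.steadyCost xr ur) D.tightenedSteadyStates (xo, uo) := by
  obtain ⟨h, hh⟩ := hne
  obtain ⟨⟨xo, uo⟩, hz, hmin⟩ := hD.steadyForm_posDef.exists_isMinOn
    D.isClosed_tightenedSteadyStates ⟨_, D.steady_of_mem_harmonicSet hh⟩ (xr, ur)
  have hminS : IsMinOn (D.steadyCost xr ur) D.tightenedSteadyStates (xo, uo) := by
    intro v hv
    change D.steadyCost xr ur (xo, uo) ≤ D.steadyCost xr ur v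
    rw [steadyCost_eq, steadyCost_eq]
    exact hmin hv
  have hmem := D.const_mem_harmonicSet_iff.2 hz
  have hminH : IsMinOn (D.offsetCost xr ur) D.harmonicSet (HarmonicVar.const xo uo) := by
    intro v hv
    change D.offsetCost xr ur (HarmonicVar.const xo uo) ≤ D.offsetCost xr ur v
    rw [offsetCost_const]
    exact (hminS (D.steady_of_mem_harmonicSet hv)).trans (hD.steadyCost_le_offsetCost xr ur v)
  refine ⟨xo, uo, ⟨hmem, hminH, fun y hy hymin => ?_⟩, ⟨hz, hminS, fun y hy hymin => ?_⟩⟩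
  · have h1 := offsetCost_add_offsetForm_sub_le hmem hminH hy
    have h2 : D.offsetCost xr ur y ≤ D.offsetCost xr ur (HarmonicVar.const xo uo) := hymin hmem
    have h3 := hD.offsetForm_posDef.nonneg (y - HarmonicVar.const xo uo)
    exact sub_eq_zero.1 (hD.offsetForm_posDef.anisotropic.eq_zero_iff.1 (by linarith))
  · have h1 := QuadraticMap.add_apply_sub_le_of_isMinOn _ D.convex_tightenedSteadyStates hz hmin hy
    have h2 : D.steadyCost xr ur y ≤ D.steadyCost xr ur (xo, uo) := hymin hz
    rw [steadyCost_eq, steadyCost_eq] at h2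
    have h3 := hD.steadyForm_posDef.nonneg (y - (xo, uo))
    exact sub_eq_zero.1 (hD.steadyForm_posDef.anisotropic.eq_zero_iff.1 (by linarith))

end HMPCData

/-! ### The shifted solution -/

/-- The candidate solution at the next sampling time: the predicted trajectory without its first
step, continued along the harmonic reference, which is advanced by one step. -/
noncomputable def HMPCDecision.shift {n m N : ℕ} (w : ℝ) (z : HMPCDecision n m N) :
    HMPCDecision n m N where
  x j := if hj : (j : ℕ) + 1 < N + 1 then z.x ⟨j + 1, hj⟩ else (HarmonicVar.atPhase w z.h).1
  u j := if hj : (j : ℕ) + 1 < N then z.u ⟨j + 1, hj⟩ else (HarmonicVar.atPhase 0 z.h).2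
  h := z.h.rotate w

namespace HMPCDecision

variable {n m N : ℕ}

theorem shift_xu_of_lt (w : ℝ) (z : HMPCDecision n m N) {j : Fin N} (hj : (j : ℕ) + 1 < N) :
    ((z.shift w).x j.castSucc, (z.shift w).u j) =
      (z.x (⟨j + 1, hj⟩ : Fin N).castSucc, z.u ⟨j + 1, hj⟩) := by
  simp [shift, hj, Fin.castSucc, Fin.castAdd, Fin.castLE]

theorem shift_xu_last (w : ℝ) (z : HMPCDecision n m N) {j : Fin N} (hj : (j : ℕ) + 1 = N)
    (hz : z.x (Fin.last N) = z.h.xe + z.h.xc) :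
    ((z.shift w).x j.castSucc, (z.shift w).u j) = HarmonicVar.atPhase 0 z.h := by
  have e : (⟨(j : ℕ) + 1, by omega⟩ : Fin (N + 1)) = Fin.last N := Fin.ext hj
  have h1 : ¬ ((j : ℕ) + 1 < N) := by omega
  simp [shift, h1, e, hz, HarmonicVar.atPhase_zero]

theorem deviation_shift_of_lt (w : ℝ) (z : HMPCDecision n m N) {j : Fin N}
    (hj : (j : ℕ) + 1 < N) :
    deviation w j (z.shift w) = deviation w ⟨j + 1, hj⟩ z := by
  rw [deviation_apply, deviation_apply, shift_xu_of_lt w z hj]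
  change _ - HarmonicVar.atPhase _ (z.h.rotate w) = _
  rw [HarmonicVar.atPhase_rotate]
  congr 3
  push_cast
  ring

theorem deviation_shift_last (w : ℝ) (z : HMPCDecision n m N) {j : Fin N} (hj : (j : ℕ) + 1 = N)
    (hz : z.x (Fin.last N) = z.h.xe + z.h.xc) : deviation w j (z.shift w) = 0 := by
  rw [deviation_apply, shift_xu_last w z hj hz]
  change _ - HarmonicVar.atPhase _ (z.h.rotate w) = _
  rw [HarmonicVar.atPhase_rotate]
  have e : w * (((j : ℕ) : ℝ) - N) + w = 0 := by
    have : (((j : ℕ) : ℝ) + 1) = N := by exact_mod_cast hj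
    rw [← this]; ring
  rw [e, sub_self]

end HMPCDecision

namespace HMPCData

variable {n m p N : ℕ} {D : HMPCData n m p}

theorem shift_mem_feasibleSet [NeZero N] {x : Fin n → ℝ} {z : HMPCDecision n m N}
    (hD : D.Assumptions) (hz : z ∈ D.feasibleSet N x) :
    z.shift D.w ∈ D.feasibleSet N (D.stepL (x, z.u 0)) := by
  rw [mem_feasibleSet_iff] at hz ⊢
  obtain ⟨hdyn, hY, h0, hlast, hH⟩ := hz
  have hH' := D.mem_harmonicSet_iff.1 hH
  have hpos : 0 < N := Nat.pos_of_ne_zero (NeZero.ne N)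
  refine ⟨fun j => ?_, fun j => ?_, ?_, ?_, D.rotate_mem_harmonicSet hH⟩
  · rcases (show (j : ℕ) + 1 ≤ N from j.2).lt_or_eq with hj | hj
    · rw [HMPCDecision.shift_xu_of_lt D.w z hj, ← hdyn]
      simp [HMPCDecision.shift, hj]
    · rw [HMPCDecision.shift_xu_last D.w z hj hlast, ← hH'.1 0, zero_add]
      simp [HMPCDecision.shift, hj]
  · rcases (show (j : ℕ) + 1 ≤ N from j.2).lt_or_eq with hj | hj
    · rw [HMPCDecision.shift_xu_of_lt D.w z hj]
      exact hY _
    · rw [HMPCDecision.shift_xu_last D.w z hj hlast]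
      refine Set.Icc_subset_Icc (fun i => ?_) (fun i => ?_) (hH'.2 0)
      · have := hD.eps_pos i
        simp only [Pi.add_apply]; linarith
      · have := hD.eps_pos i
        simp only [Pi.sub_apply]; linarith
  · have h := hdyn 0
    rw [Fin.castSucc_zero', h0] at h
    rw [← h]
    have e : (0 : Fin N).succ = ⟨1, Nat.succ_lt_succ hpos⟩ := Fin.ext (by simp [hpos])
    rw [e]
    simp [HMPCDecision.shift, hpos]
  · have : (z.shift D.w).x (Fin.last N) = (HarmonicVar.atPhase D.w z.h).1 := by
      simp [HMPCDecision.shift]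
    rw [this]
    have e := HarmonicVar.atPhase_rotate 0 D.w z.h
    rw [zero_add, HarmonicVar.atPhase_zero] at e
    rw [← e]
    rfl

theorem trackingForm_shift [NeZero N] {z : HMPCDecision n m N}
    (hz : z.x (Fin.last N) = z.h.xe + z.h.xc) :
    D.trackingForm N (z.shift D.w) + D.stageForm (HMPCDecision.deviation D.w 0 z) =
      D.trackingForm N z := by
  let g : ℕ → ℝ := fun j =>
    if hj : j < N then D.stageForm (HMPCDecision.deviation D.w ⟨j, hj⟩ z) else 0
  have hpos : 0 < N := Nat.pos_of_ne_zero (NeZero.ne N)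
  have h1 : D.trackingForm N z = ∑ j ∈ Finset.range N, g j := by
    rw [trackingForm_apply, Finset.sum_range]
    exact Finset.sum_congr rfl fun j _ => by simp [g]
  have h2 : D.trackingForm N (z.shift D.w) = ∑ j ∈ Finset.range N, g (j + 1) := by
    rw [trackingForm_apply, Finset.sum_range]
    refine Finset.sum_congr rfl fun j _ => ?_
    rcases (show (j : ℕ) + 1 ≤ N from j.2).lt_or_eq with hj | hj
    · rw [HMPCDecision.deviation_shift_of_lt D.w z hj]
      simp [g, hj]
    · rw [HMPCDecision.deviation_shift_last D.w z hj hz]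
      simp [g, hj]
  have h3 : D.stageForm (HMPCDecision.deviation D.w 0 z) = g 0 := by
    simp only [g, hpos, dite_true]
    rfl
  have h4 : g N = 0 := by simp [g]
  rw [h1, h2, h3, ← Finset.sum_range_succ', Finset.sum_range_succ, h4, add_zero]

theorem totalCost_shift [NeZero N] {x xr : Fin n → ℝ} {ur : Fin m → ℝ} {z : HMPCDecision n m N}
    (hz : z ∈ D.feasibleSet N x) :
    D.totalCost N xr ur (z.shift D.w) + D.stageForm (HMPCDecision.deviation D.w 0 z) =
      D.totalCost N xr ur z := by
  rw [totalCost_eq_add, totalCost_eq_add, ← trackingForm_shift hz.2.2.2.1]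
  have : D.offsetCost xr ur (z.shift D.w).h = D.offsetCost xr ur z.h :=
    D.offsetCost_rotate xr ur z.h D.w
  rw [this]
  ring

/-! ### Feasible perturbations -/

/-- Directions in the space of decisions, linear in the change of the initial state and of the
harmonic reference, which preserve the dynamics and the terminal constraint. -/
theorem Assumptions.exists_direction (hD : D.Assumptions)
    (hN : controllabilityIndex D.A D.B ≤ N) :
    ∃ K : (Fin n → ℝ) × HarmonicVar n m →ₗ[ℝ] HMPCDecision n m N,
      ∀ v, (∀ j : Fin N, (K v).x j.succ = D.stepL ((K v).x j.castSucc, (K v).u j)) ∧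
        (K v).x 0 = v.1 ∧ (K v).x (Fin.last N) = v.2.xe + v.2.xc ∧ (K v).h = v.2 := by
  obtain ⟨S, hS⟩ := hD.controllable.exists_steering hN
  let e : (Fin n → ℝ) × HarmonicVar n m →ₗ[ℝ] (Fin n → ℝ) × (Fin n → ℝ) :=
    (LinearMap.fst ℝ _ _).prod ((HarmonicVar.xeL + HarmonicVar.xcL).comp (LinearMap.snd ℝ _ _))
  let P : (Fin n → ℝ) × HarmonicVar n m →ₗ[ℝ]
      (Fin (N + 1) → Fin n → ℝ) × (Fin N → Fin m → ℝ) × HarmonicVar n m :=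
    ((LinearMap.fst ℝ _ _).comp (S.comp e)).prod
      (((LinearMap.snd ℝ _ _).comp (S.comp e)).prod (LinearMap.snd ℝ _ _))
  refine ⟨(HMPCDecision.linearEquivProd n m N).symm.toLinearMap.comp P, fun v => ?_⟩
  obtain ⟨h1, h2, h3⟩ := hS (e v)
  refine ⟨fun j => ?_, h2, h3, rfl⟩
  rw [stepL_apply]
  exact h1 j

theorem add_direction_mem_feasibleSet
    {K : (Fin n → ℝ) × HarmonicVar n m →ₗ[ℝ] HMPCDecision n m N}
    (hK : ∀ v, (∀ j : Fin N, (K v).x j.succ = D.stepL ((K v).x j.castSucc, (K v).u j)) ∧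
        (K v).x 0 = v.1 ∧ (K v).x (Fin.last N) = v.2.xe + v.2.xc ∧ (K v).h = v.2)
    {x : Fin n → ℝ} {z : HMPCDecision n m N} (hz : z ∈ D.feasibleSet N x)
    {v : (Fin n → ℝ) × HarmonicVar n m} (hH : z.h + v.2 ∈ D.harmonicSet)
    (hY : ∀ j : Fin N, D.outputL (HMPCDecision.xuL j (z + K v)) ∈ Set.Icc D.ylo D.yhi) :
    z + K v ∈ D.feasibleSet N (x + v.1) := by
  obtain ⟨k1, k2, k3, k4⟩ := hK v
  rw [mem_feasibleSet_iff] at hz ⊢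
  obtain ⟨hdyn, -, h0, hlast, -⟩ := hz
  refine ⟨fun j => ?_, hY, ?_, ?_, ?_⟩
  · have : ((z + K v).x j.castSucc, (z + K v).u j)
        = (z.x j.castSucc, z.u j) + ((K v).x j.castSucc, (K v).u j) := rfl
    rw [this, map_add, ← k1, ← hdyn]
    rfl
  · rw [← h0, ← k2]; rfl
  · simp only [HMPCDecision.add_x, HMPCDecision.add_h, Pi.add_apply, hlast, k3, k4,
      HarmonicVar.add_xe, HarmonicVar.add_xc]
    abel
  · rw [HMPCDecision.add_h, k4]; exact hH

theorem const_mem_feasibleSet (hD : D.Assumptions) {xo : Fin n → ℝ} {uo : Fin m → ℝ}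
    (ho : (xo, uo) ∈ D.tightenedSteadyStates) :
    (HMPCDecision.const xo uo : HMPCDecision n m N) ∈ D.feasibleSet N xo := by
  have ho' := D.mem_tightenedSteadyStates_iff.1 ho
  rw [mem_feasibleSet_iff]
  refine ⟨fun j => ho'.1, fun j => ?_, rfl, ?_, D.const_mem_harmonicSet_iff.2 ho⟩
  · refine Set.Icc_subset_Icc (fun i => ?_) (fun i => ?_) ho'.2
    · have := hD.eps_pos i
      simp only [Pi.add_apply]; linarith
    · have := hD.eps_pos i
      simp only [Pi.sub_apply]; linarith
  · simp [HMPCDecision.const, HarmonicVar.const]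

theorem totalCost_const (xr xo : Fin n → ℝ) (ur uo : Fin m → ℝ) :
    D.totalCost N xr ur (HMPCDecision.const xo uo) =
      D.offsetCost xr ur (HarmonicVar.const xo uo) := by
  rw [totalCost_eq_add, trackingForm_apply]
  simp only [HMPCDecision.deviation_const, QuadraticMap.map_zero, Finset.sum_const_zero, zero_add]
  rfl

/-- The cost of a feasible decision exceeds the optimal offset cost by at least the cost form of the deviation
from the decision that stays at the optimal steady state. -/
theorem costForm_sub_const_le {xr xo x : Fin n → ℝ} {ur uo : Fin m → ℝ}
    (ho : IsUniqueMinimizer (D.offsetCost xr ur) D.harmonicSet (HarmonicVar.const xo uo))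
    {z : HMPCDecision n m N} (hz : z ∈ D.feasibleSet N x) :
    D.costForm N (z - HMPCDecision.const xo uo) ≤
      D.totalCost N xr ur z - D.offsetCost xr ur (HarmonicVar.const xo uo) := by
  have h1 := offsetCost_add_offsetForm_sub_le ho.1 ho.2.1 hz.2.2.2.2
  rw [← D.totalCost_eq xo uo hz.2.2.2.1, totalCost_eq_add, totalCost_eq_add, offsetCost_eq D xo uo]
  linarith

theorem isMinOn_const {xr xo : Fin n → ℝ} {ur uo : Fin m → ℝ} (hD : D.Assumptions)
    (ho : IsUniqueMinimizer (D.offsetCost xr ur) D.harmonicSet (HarmonicVar.const xo uo)) :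
    IsMinOn (D.totalCost N xr ur) (D.feasibleSet N xo) (HMPCDecision.const xo uo) := by
  intro y hy
  change D.totalCost N xr ur (HMPCDecision.const xo uo) ≤ D.totalCost N xr ur y
  have h1 := costForm_sub_const_le ho hy
  have h2 := hD.costForm_posDef.nonneg (y - HMPCDecision.const xo uo)
  rw [totalCost_const]
  linarith

/-- Near the optimal steady state the problem is feasible, with optimal cost close to the optimal
offset cost: by controllability a small deviation is steered to zero within the horizon, and the
tightening leaves room for it in the constraints. -/
theorem Assumptions.eventually_exists_feasible (hD : D.Assumptions)
    (hN : controllabilityIndex D.A D.B ≤ N) (xr : Fin n → ℝ) (ur : Fin m → ℝ) {xo : Fin n → ℝ}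
    {uo : Fin m → ℝ} (ho : (xo, uo) ∈ D.tightenedSteadyStates) {ε : ℝ} (hε : 0 < ε) :
    ∀ᶠ x in 𝓝 xo, ∃ y ∈ D.feasibleSet N x,
      D.totalCost N xr ur y < D.offsetCost xr ur (HarmonicVar.const xo uo) + ε := by
  obtain ⟨K, hK⟩ := hD.exists_direction hN
  have hKc : Continuous K := K.continuous_of_finiteDimensional
  let zo : HMPCDecision n m N := HMPCDecision.const xo uo
  let y : (Fin n → ℝ) → HMPCDecision n m N := fun x => zo + K (x - xo, 0)
  have hyc : Continuous y := by fun_prop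
  have hyo : y xo = zo := by
    have : ((0 : Fin n → ℝ), (0 : HarmonicVar n m)) = 0 := rfl
    simp only [y, sub_self, this, map_zero, add_zero]
  have hzo : zo ∈ D.feasibleSet N xo := const_mem_feasibleSet hD ho
  have hout : ∀ᶠ x in 𝓝 xo, ∀ j : Fin N,
      D.outputL (HMPCDecision.xuL j (y x)) ∈ Set.Icc D.ylo D.yhi := by
    refine eventually_all.2 fun j => ?_
    have hc : Continuous fun x => D.outputL (HMPCDecision.xuL j (y x)) :=
      (D.outputL.comp (HMPCDecision.xuL j)).continuous_of_finiteDimensional.comp hyc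
    refine hc.continuousAt.eventually (pi_Icc_mem_nhds (fun i => ?_) (fun i => ?_))
    · have h1 := (D.mem_tightenedSteadyStates_iff.1 ho).2.1 i
      have h2 := hD.eps_pos i
      simp only [Pi.add_apply] at h1
      beta_reduce
      rw [hyo]
      exact lt_of_lt_of_le (by linarith) h1
    · have h1 := (D.mem_tightenedSteadyStates_iff.1 ho).2.2 i
      have h2 := hD.eps_pos i
      simp only [Pi.sub_apply] at h1
      beta_reduce
      rw [hyo]
      exact lt_of_le_of_lt h1 (by linarith)
  have hcost : ∀ᶠ x in 𝓝 xo, D.costForm N (y x - HMPCDecision.const xr ur) <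
      D.offsetCost xr ur (HarmonicVar.const xo uo) + ε := by
    have hc : Continuous fun x => D.costForm N (y x - HMPCDecision.const xr ur) :=
      (D.costForm N).continuous_of_finiteDimensional.comp (hyc.sub continuous_const)
    refine hc.continuousAt.eventually_lt_const ?_
    beta_reduce
    rw [hyo, ← totalCost_eq_of_mem xr ur hzo, totalCost_const]
    linarith
  filter_upwards [hout, hcost] with x h1 h2
  have hy : y x ∈ D.feasibleSet N x := by
    have := add_direction_mem_feasibleSet hK hzo (v := (x - xo, 0))
      (by rw [add_zero]; exact hzo.2.2.2.2) h1
    rwa [add_sub_cancel] at this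
  exact ⟨y x, hy, by rwa [totalCost_eq_of_mem xr ur hy]⟩

end HMPCData

namespace HMPCData

variable {n m p N : ℕ} {D : HMPCData n m p}

/-! ### Convergence of the closed loop -/

/-- Optimal solutions of the problem along a closed-loop trajectory, one for each sampling time;
the closed-loop state at time `t` is the initial state of the `t`-th solution. -/
structure OptimalRun [NeZero N] (D : HMPCData n m p) (xr : Fin n → ℝ) (ur : Fin m → ℝ)
    (z : ℕ → HMPCDecision n m N) : Prop where
  feasible : ∀ t, z t ∈ D.feasibleSet N ((z t).x 0)
  optimal : ∀ t, IsMinOn (D.totalCost N xr ur) (D.feasibleSet N ((z t).x 0)) (z t)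
  step : ∀ t, (z (t + 1)).x 0 = D.stepL ((z t).x 0, (z t).u 0)

namespace OptimalRun

variable [NeZero N] {xr : Fin n → ℝ} {ur : Fin m → ℝ} {z : ℕ → HMPCDecision n m N}

theorem totalCost_step (hz : D.OptimalRun xr ur z) (hD : D.Assumptions) (t : ℕ) :
    D.totalCost N xr ur (z (t + 1)) + D.costForm N ((z t).shift D.w - z (t + 1))
      + D.stageForm (HMPCDecision.deviation D.w 0 (z t)) ≤ D.totalCost N xr ur (z t) := by
  have h1 := shift_mem_feasibleSet hD (hz.feasible t)
  rw [← hz.step t] at h1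
  have h2 := totalCost_add_costForm_sub_le (hz.feasible (t + 1)) (hz.optimal (t + 1)) h1
  have h3 := totalCost_shift (xr := xr) (ur := ur) (hz.feasible t)
  linarith

theorem antitone_totalCost (hz : D.OptimalRun xr ur z) (hD : D.Assumptions) :
    Antitone fun t => D.totalCost N xr ur (z t) := by
  refine antitone_nat_of_succ_le fun t => ?_
  have h1 := hz.totalCost_step hD t
  have h2 := hD.costForm_posDef.nonneg ((z t).shift D.w - z (t + 1))
  have h3 := hD.stageForm_posDef.nonneg (HMPCDecision.deviation D.w 0 (z t))
  linarith

theorem tendsto_totalCost_sub (hz : D.OptimalRun xr ur z) (hD : D.Assumptions) :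
    Tendsto (fun t => D.totalCost N xr ur (z t) - D.totalCost N xr ur (z (t + 1)))
      atTop (𝓝 0) := by
  have hbdd : BddBelow (Set.range fun t => D.totalCost N xr ur (z t)) := by
    refine ⟨0, ?_⟩
    rintro _ ⟨t, rfl⟩
    beta_reduce
    rw [totalCost_eq_of_mem xr ur (hz.feasible t)]
    exact hD.costForm_posDef.nonneg _
  have h := tendsto_atTop_ciInf (hz.antitone_totalCost hD) hbdd
  have := h.sub (h.comp (tendsto_add_atTop_nat 1))
  rwa [sub_self] at this

/-- All predicted deviations from the artificial harmonic reference vanish asymptotically. The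
first one does because it bounds the decrease of the optimal cost. The shifted solution is
asymptotically optimal, so that by strong convexity it approaches the next optimal solution, and
each deviation becomes the preceding one at the next time. -/
theorem tendsto_deviation (hz : D.OptimalRun xr ur z) (hD : D.Assumptions) (j : Fin N) :
    Tendsto (fun t => HMPCDecision.deviation D.w j (z t)) atTop (𝓝 0) := by
  have hdiff := hz.tendsto_totalCost_sub hD
  have hshift : Tendsto (fun t => (z t).shift D.w - z (t + 1)) atTop (𝓝 0) := by
    refine hD.costForm_posDef.tendsto_zero
      (squeeze_zero (fun t => hD.costForm_posDef.nonneg _) (fun t => ?_) hdiff)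
    have h1 := hz.totalCost_step hD t
    have h3 := hD.stageForm_posDef.nonneg (HMPCDecision.deviation D.w 0 (z t))
    linarith
  obtain ⟨j, hj⟩ := j
  induction j with
  | zero =>
    refine hD.stageForm_posDef.tendsto_zero
      (squeeze_zero (fun t => hD.stageForm_posDef.nonneg _) (fun t => ?_) hdiff)
    have h1 := hz.totalCost_step hD t
    have h2 := hD.costForm_posDef.nonneg ((z t).shift D.w - z (t + 1))
    have e : (⟨0, hj⟩ : Fin N) = 0 := rfl
    rw [e]
    linarith
  | succ j ih =>
    have hj' : j < N := by omega
    have h1 := (ih hj').comp (tendsto_add_atTop_nat 1)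
    have hc : Continuous (HMPCDecision.deviation (n := n) (m := m) D.w (⟨j, hj'⟩ : Fin N)) :=
      LinearMap.continuous_of_finiteDimensional _
    have h2 := (hc.tendsto 0).comp hshift
    rw [map_zero] at h2
    have h3 := h1.add h2
    rw [add_zero] at h3
    refine h3.congr fun t => ?_
    rw [← HMPCDecision.deviation_shift_of_lt D.w (z t) (j := ⟨j, hj'⟩) hj]
    simp only [Function.comp_apply, map_sub]
    abel

theorem tendsto_trackingForm (hz : D.OptimalRun xr ur z) (hD : D.Assumptions) :
    Tendsto (fun t => D.trackingForm N (z t)) atTop (𝓝 0) := by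
  simp only [trackingForm_apply]
  have h : ∀ j : Fin N, Tendsto
      (fun t => D.stageForm (HMPCDecision.deviation D.w j (z t))) atTop (𝓝 0) := by
    intro j
    have := (D.stageForm.continuous_of_finiteDimensional.tendsto 0).comp (hz.tendsto_deviation hD j)
    rwa [QuadraticMap.map_zero] at this
  simpa using tendsto_finsetSum Finset.univ fun j _ => h j

/-- The artificial harmonic reference converges to the optimal one. Once the predicted trajectory
is close to the reference, it keeps a distance from the constraints, so that the reference can be
moved a fixed fraction `s` of the way to the optimum. This lowers the offset cost by at least
`s` times the squared distance to the optimum, and raises the tracking cost only by a multiple of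
`s ^ 2` times the squared distance. -/
theorem tendsto_harmonic (hz : D.OptimalRun xr ur z) (hD : D.Assumptions)
    (hN : controllabilityIndex D.A D.B ≤ N) {ho : HarmonicVar n m}
    (hmin : IsUniqueMinimizer (D.offsetCost xr ur) D.harmonicSet ho) :
    Tendsto (fun t => (z t).h) atTop (𝓝 ho) := by
  obtain ⟨K, hK⟩ := hD.exists_direction hN
  let G : HarmonicVar n m →ₗ[ℝ] HMPCDecision n m N :=
    K.comp (LinearMap.inr ℝ (Fin n → ℝ) (HarmonicVar n m))
  have hG : ∀ d, G d = K (0, d) := fun d => rfl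
  obtain ⟨C, hC, hCb⟩ := hD.offsetForm_posDef.exists_apply_le ((D.trackingForm N).comp G)
  have hout : ∀ j : Fin N, ∃ C > 0, ∀ d,
      ‖D.outputL (HMPCDecision.xuL j (G d))‖ ^ 2 ≤ C * D.offsetForm d := fun j =>
    hD.offsetForm_posDef.exists_norm_sq_le (D.outputL.comp ((HMPCDecision.xuL j).comp G))
  choose c hc hcb using hout
  let d : ℕ → HarmonicVar n m := fun t => ho - (z t).h
  -- strong convexity of the offset cost
  have hgap : ∀ t, D.offsetCost xr ur ho + D.offsetForm (d t) ≤ D.offsetCost xr ur (z t).h := by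
    intro t
    have := offsetCost_add_offsetForm_sub_le hmin.1 hmin.2.1 (hz.feasible t).2.2.2.2
    rwa [QuadraticMap.map_sub] at this
  let M : ℝ := D.totalCost N xr ur (z 0) - D.offsetCost xr ur ho
  have hM : ∀ t, D.offsetForm (d t) ≤ M := by
    intro t
    have h1 := hgap t
    have h2 : D.totalCost N xr ur (z t) ≤ D.totalCost N xr ur (z 0) :=
      hz.antitone_totalCost hD (Nat.zero_le t)
    have h3 := hD.trackingForm_nonneg (z t)
    rw [totalCost_eq_add] at h2
    simp only [M]
    linarith
  obtain ⟨s, ⟨hs1, hs2⟩, hs0, hs3⟩ : ∃ s : ℝ,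
      ((∀ j i, s ^ 2 * (c j * M) < (D.eps i / 2) ^ 2) ∧ s * C < 1 / 4) ∧ 0 < s ∧ s ≤ 1 := by
    have h1 : ∀ᶠ s : ℝ in 𝓝[>] 0, ∀ j i, s ^ 2 * (c j * M) < (D.eps i / 2) ^ 2 := by
      refine eventually_all.2 fun j => eventually_all.2 fun i => ?_
      have hct : Continuous fun s : ℝ => s ^ 2 * (c j * M) := by fun_prop
      refine hct.continuousWithinAt.eventually_lt_const ?_
      have := hD.eps_pos i
      simp only [ne_eq, OfNat.ofNat_ne_zero, not_false_eq_true, zero_pow, zero_mul]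
      positivity
    have h2 : ∀ᶠ s : ℝ in 𝓝[>] 0, s * C < 1 / 4 := by
      have hct : Continuous fun s : ℝ => s * C := by fun_prop
      exact hct.continuousWithinAt.eventually_lt_const (by norm_num)
    obtain ⟨s, hs⟩ := ((h1.and h2).and (Ioc_mem_nhdsGT one_pos)).exists
    exact ⟨s, hs⟩
  have hdev : ∀ᶠ t in atTop, ∀ j : Fin N, ∀ i,
      |D.outputL (HMPCDecision.deviation D.w j (z t)) i| < D.eps i / 2 := by
    refine eventually_all.2 fun j => eventually_all.2 fun i => ?_
    have hct : Continuous fun v => |D.outputL v i| :=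
      ((continuous_apply i).comp D.outputL.continuous_of_finiteDimensional).abs
    have h := (hct.tendsto 0).comp (hz.tendsto_deviation hD j)
    simp only [map_zero, Pi.zero_apply, abs_zero] at h
    exact h.eventually_lt_const (half_pos (hD.eps_pos i))
  have hkey : ∀ᶠ t in atTop, D.offsetForm (d t) ≤ 2 / s * D.trackingForm N (z t) := by
    filter_upwards [hdev] with t ht
    have hzt := hz.feasible t
    have hsd : ((0 : Fin n → ℝ), s • d t) = s • ((0 : Fin n → ℝ), d t) := by simp
    have hKs : K (0, s • d t) = s • G (d t) := by rw [hsd, map_smul, hG]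
    have hmem : z t + K (0, s • d t) ∈ D.feasibleSet N ((z t).x 0) := by
      have := add_direction_mem_feasibleSet hK hzt (v := (0, s • d t))
        (D.convex_harmonicSet.add_smul_sub_mem hzt.2.2.2.2 hmin.1 ⟨hs0.le, hs3⟩) (fun j => ?_)
      · rwa [add_zero] at this
      -- the harmonic reference, the deviation from it, and the change of direction
      have e : D.outputL (HMPCDecision.xuL j (z t + K (0, s • d t))) =
          D.outputL (HarmonicVar.atPhase (D.w * ((j : ℕ) - N)) (z t).h)
          + D.outputL (HMPCDecision.deviation D.w j (z t))
          + s • D.outputL (HMPCDecision.xuL j (G (d t))) := by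
        rw [HMPCDecision.deviation_apply, ← HMPCDecision.xuL_apply, hKs]
        simp only [map_add, map_sub, map_smul]
        abel
      have hb : ∀ i, |s * D.outputL (HMPCDecision.xuL j (G (d t))) i| < D.eps i / 2 := by
        intro i
        have he := half_pos (hD.eps_pos i)
        refine abs_lt_of_sq_lt_sq ?_ he.le
        have h1 : |D.outputL (HMPCDecision.xuL j (G (d t))) i| ≤
            ‖D.outputL (HMPCDecision.xuL j (G (d t)))‖ :=
          norm_le_pi_norm (D.outputL (HMPCDecision.xuL j (G (d t)))) i
        have h2 : D.outputL (HMPCDecision.xuL j (G (d t))) i ^ 2 ≤ c j * M := by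
          rw [← sq_abs]
          calc _ ≤ ‖D.outputL (HMPCDecision.xuL j (G (d t)))‖ ^ 2 := by gcongr
            _ ≤ c j * D.offsetForm (d t) := hcb j _
            _ ≤ c j * M := by have := hc j; have := hM t; gcongr
        calc _ = s ^ 2 * D.outputL (HMPCDecision.xuL j (G (d t))) i ^ 2 := by ring
          _ ≤ s ^ 2 * (c j * M) := by gcongr
          _ < _ := hs1 j i
      have hH := (D.mem_harmonicSet_iff.1 hzt.2.2.2.2).2 (D.w * ((j : ℕ) - N))
      rw [e]
      refine ⟨fun i => ?_, fun i => ?_⟩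
      · have h1 := hH.1 i
        have h2 := abs_lt.1 (ht j i)
        have h3 := abs_lt.1 (hb i)
        simp only [Pi.add_apply, Pi.smul_apply, smul_eq_mul] at h1 ⊢
        linarith
      · have h1 := hH.2 i
        have h2 := abs_lt.1 (ht j i)
        have h3 := abs_lt.1 (hb i)
        simp only [Pi.add_apply, Pi.sub_apply, Pi.smul_apply, smul_eq_mul] at h1 ⊢
        linarith
    have hopt : D.totalCost N xr ur (z t) ≤ D.totalCost N xr ur (z t + K (0, s • d t)) :=
      hz.optimal t hmem
    rw [totalCost_eq_add, totalCost_eq_add] at hopt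
    have htrack : D.trackingForm N (z t + K (0, s • d t)) ≤
        2 * D.trackingForm N (z t) + 2 * (s ^ 2 * (C * D.offsetForm (d t))) := by
      refine (QuadraticMap.apply_add_le _ hD.trackingForm_nonneg _ _).trans ?_
      have h1 : D.trackingForm N (G (d t)) ≤ C * D.offsetForm (d t) := hCb (d t)
      rw [hKs, QuadraticMap.map_smul, smul_eq_mul, ← pow_two]
      gcongr
    have hoff : D.offsetCost xr ur (z t + K (0, s • d t)).h ≤
        (1 - s) * D.offsetCost xr ur (z t).h + s * D.offsetCost xr ur ho := by
      have h1 : (z t + K (0, s • d t)).h = (z t).h + s • d t := by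
        rw [HMPCDecision.add_h, (hK _).2.2.2]
      have h2 : (z t).h + s • d t - HarmonicVar.const xr ur = ((z t).h - HarmonicVar.const xr ur)
          + s • ((ho - HarmonicVar.const xr ur) - ((z t).h - HarmonicVar.const xr ur)) := by
        simp only [d]; module
      rw [h1, offsetCost_eq, offsetCost_eq, offsetCost_eq, h2, QuadraticMap.apply_lineMap]
      have h3 := hD.offsetForm_posDef.nonneg
        ((ho - HarmonicVar.const xr ur) - ((z t).h - HarmonicVar.const xr ur))
      have h4 : 0 ≤ s * (1 - s) := mul_nonneg hs0.le (by linarith)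
      have := mul_nonneg h4 h3
      linarith
    have hnn := hD.offsetForm_posDef.nonneg (d t)
    have h5 : s * D.offsetForm (d t) ≤
        s * (D.offsetCost xr ur (z t).h - D.offsetCost xr ur ho) := by
      have := hgap t
      gcongr
      linarith
    have h6 : s ^ 2 * (C * D.offsetForm (d t)) ≤ s * (1 / 4 * D.offsetForm (d t)) := by
      calc _ = s * ((s * C) * D.offsetForm (d t)) := by ring
        _ ≤ _ := by gcongr
    have h7 : s * D.offsetForm (d t) ≤ 2 * D.trackingForm N (z t) := by linarith
    rw [div_mul_eq_mul_div, le_div_iff₀ hs0]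
    linarith
  have hlim : Tendsto (fun t => D.offsetForm (d t)) atTop (𝓝 0) := by
    have h := (hz.tendsto_trackingForm hD).const_mul (2 / s)
    rw [mul_zero] at h
    exact squeeze_zero' (Eventually.of_forall fun t => hD.offsetForm_posDef.nonneg _) hkey h
  have h0 := hD.offsetForm_posDef.tendsto_zero hlim
  have := h0.const_sub ho
  simpa [d] using this

theorem tendsto_state_input (hz : D.OptimalRun xr ur z) (hD : D.Assumptions)
    (hN : controllabilityIndex D.A D.B ≤ N) {xo : Fin n → ℝ} {uo : Fin m → ℝ}
    (ho : IsUniqueMinimizer (D.offsetCost xr ur) D.harmonicSet (HarmonicVar.const xo uo)) :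
    Tendsto (fun t => ((z t).x 0, (z t).u 0)) atTop (𝓝 (xo, uo)) := by
  let θ : ℝ := D.w * (((0 : Fin N) : ℕ) - N)
  have hc : Continuous (HarmonicVar.atPhase (n := n) (m := m) θ) :=
    LinearMap.continuous_of_finiteDimensional _
  have h1 := (hc.tendsto _).comp (hz.tendsto_harmonic hD hN ho)
  have h2 := (hz.tendsto_deviation hD 0).add h1
  rw [HarmonicVar.atPhase_const, zero_add] at h2
  refine h2.congr fun t => ?_
  rw [Function.comp_apply, HMPCDecision.deviation_apply, Fin.castSucc_zero']
  exact sub_add_cancel _ _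

end OptimalRun

/-! ### The closed loop -/

section ClosedLoop

variable [NeZero N]

theorem closedLoop_eq (xr : Fin n → ℝ) (ur : Fin m → ℝ) (x : Fin n → ℝ) :
    D.closedLoop N xr ur x = D.stepL (x, D.controlLaw N xr ur x) :=
  (D.stepL_apply (x, D.controlLaw N xr ur x)).symm

theorem Assumptions.closedLoop_mem (hD : D.Assumptions) (xr : Fin n → ℝ) (ur : Fin m → ℝ)
    {x : Fin n → ℝ} (hx : x ∈ D.feasibilityRegion N) :
    D.closedLoop N xr ur x ∈ D.feasibilityRegion N := by
  obtain ⟨z, hz, hmin, -⟩ := hD.exists_isUniqueMinimizer_totalCost xr ur hx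
  rw [closedLoop_eq, hD.controlLaw_eq hz hmin]
  exact ⟨_, shift_mem_feasibleSet hD hz⟩

theorem Assumptions.closedLoopState_mem (hD : D.Assumptions) (xr : Fin n → ℝ) (ur : Fin m → ℝ)
    {x : Fin n → ℝ} (hx : x ∈ D.feasibilityRegion N) (t : ℕ) :
    D.closedLoopState N xr ur x t ∈ D.feasibilityRegion N := by
  induction t with
  | zero => exact hx
  | succ t ih =>
    rw [closedLoopState, Function.iterate_succ_apply']
    exact hD.closedLoop_mem xr ur ih

theorem Assumptions.exists_optimalRun (hD : D.Assumptions) (xr : Fin n → ℝ) (ur : Fin m → ℝ)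
    {x : Fin n → ℝ} (hx : x ∈ D.feasibilityRegion N) :
    ∃ z : ℕ → HMPCDecision n m N, D.OptimalRun xr ur z ∧
      (∀ t, (z t).x 0 = D.closedLoopState N xr ur x t) ∧
      ∀ t, (z t).u 0 = D.closedLoopInput N xr ur x t := by
  choose z hz using fun t =>
    hD.exists_isUniqueMinimizer_totalCost xr ur (hD.closedLoopState_mem xr ur hx t)
  have hx0 : ∀ t, (z t).x 0 = D.closedLoopState N xr ur x t := fun t => (hz t).1.2.2.1
  have hu0 : ∀ t, (z t).u 0 = D.closedLoopInput N xr ur x t := fun t =>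
    (hD.controlLaw_eq (hz t).1 (hz t).2.1).symm
  refine ⟨z, ⟨fun t => ?_, fun t => ?_, fun t => ?_⟩, hx0, hu0⟩
  · rw [hx0]; exact (hz t).1
  · rw [hx0]; exact (hz t).2.1
  · rw [hx0, hx0, hu0, closedLoopState, Function.iterate_succ_apply', closedLoop_eq]
    rfl

theorem Assumptions.closedLoop_steady (hD : D.Assumptions) {xr xo : Fin n → ℝ}
    {ur uo : Fin m → ℝ}
    (ho : IsUniqueMinimizer (D.offsetCost xr ur) D.harmonicSet (HarmonicVar.const xo uo)) :
    D.closedLoop N xr ur xo = xo := by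
  have ho' := D.const_mem_harmonicSet_iff.1 ho.1
  rw [closedLoop_eq, hD.controlLaw_eq (const_mem_feasibleSet hD ho') (isMinOn_const hD ho)]
  exact (D.mem_tightenedSteadyStates_iff.1 ho').1.symm

/-- The optimal cost minus the optimal offset cost is a Lyapunov function. -/
theorem Assumptions.isLyapunovStable (hD : D.Assumptions)
    (hN : controllabilityIndex D.A D.B ≤ N) {xr xo : Fin n → ℝ} {ur uo : Fin m → ℝ}
    (ho : IsUniqueMinimizer (D.offsetCost xr ur) D.harmonicSet (HarmonicVar.const xo uo)) :
    IsLyapunovStable (D.closedLoop N xr ur) xo := by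
  refine ⟨hD.closedLoop_steady ho, fun η hη => ?_⟩
  obtain ⟨C, hC, hCb⟩ := (hD.costForm_posDef (N := N)).exists_norm_sq_le
    ((WithLp.linearEquiv 2 ℝ (Fin n → ℝ)).symm.toLinearMap.comp (HMPCDecision.xL 0))
  have hev := hD.eventually_exists_feasible hN xr ur (D.const_mem_harmonicSet_iff.1 ho.1)
    (ε := η ^ 2 / C) (by positivity)
  obtain ⟨δ, hδ, hball⟩ := Metric.eventually_nhds_iff.1 hev
  refine ⟨δ, hδ, fun x hx t => ?_⟩
  have hdist : dist x xo < δ := by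
    refine lt_of_le_of_lt ?_ hx
    rw [dist_eq_norm]
    exact (pi_norm_le_iff_of_nonneg (norm_nonneg _)).2 fun i =>
      PiLp.norm_apply_le (WithLp.toLp 2 (x - xo)) i
  obtain ⟨y, hy, hycost⟩ := hball hdist
  obtain ⟨z, hz, hx0, -⟩ := hD.exists_optimalRun xr ur ⟨y, hy⟩
  have h1 : D.totalCost N xr ur (z t) ≤ D.totalCost N xr ur (z 0) :=
    hz.antitone_totalCost hD (Nat.zero_le t)
  have h2 : D.totalCost N xr ur (z 0) ≤ D.totalCost N xr ur y :=
    hz.optimal 0 (by rw [hx0]; exact hy)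
  have h3 := costForm_sub_const_le ho (hz.feasible t)
  have h4 := hCb (z t - HMPCDecision.const xo uo)
  have e : ((WithLp.linearEquiv 2 ℝ (Fin n → ℝ)).symm.toLinearMap.comp (HMPCDecision.xL 0))
      (z t - HMPCDecision.const xo uo) = WithLp.toLp 2 ((z t).x 0 - xo) := rfl
  rw [e, hx0] at h4
  change ‖WithLp.toLp 2 (D.closedLoopState N xr ur x t - xo)‖ < η
  refine lt_of_pow_lt_pow_left₀ 2 hη.le (h4.trans_lt ?_)
  rw [← lt_div_iff₀' hC]
  linarith

end ClosedLoop

end HMPCData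

theorem theorem6p15 {n m p N : ℕ} [NeZero N] (D : HMPCData n m p) (hD : D.Assumptions)
    (hN : controllabilityIndex D.A D.B ≤ N) (xr : Fin n → ℝ) (ur : Fin m → ℝ)
    (hfeas : (D.feasibilityRegion N).Nonempty) :
    -- the control law is well defined on the feasibility region
    (∀ x ∈ D.feasibilityRegion N, ∃ z : HMPCDecision n m N,
      IsUniqueMinimizer (D.totalCost N xr ur) (D.feasibleSet N x) z) ∧
    ∃ (xo : Fin n → ℝ) (uo : Fin m → ℝ),
      -- `(xo, uo)` is the optimal artificial harmonic reference, an admissible steady state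
      IsUniqueMinimizer (D.offsetCost xr ur) D.harmonicSet (HarmonicVar.const xo uo) ∧
      IsUniqueMinimizer (D.steadyCost xr ur) D.tightenedSteadyStates (xo, uo) ∧
      -- stability of the closed loop
      xo ∈ interior (D.feasibilityRegion N) ∧
      IsLyapunovStable (D.closedLoop N xr ur) xo ∧
      -- feasibility, constraint satisfaction and convergence from every feasible initial state
      ∀ x₀ ∈ D.feasibilityRegion N,
        (∀ t, D.closedLoopState N xr ur x₀ t ∈ D.feasibilityRegion N) ∧
        (∀ t, (D.closedLoopState N xr ur x₀ t, D.closedLoopInput N xr ur x₀ t)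
          ∈ D.constraintSet) ∧
        Tendsto (D.closedLoopState N xr ur x₀) atTop (𝓝 xo) ∧
        Tendsto (D.closedLoopInput N xr ur x₀) atTop (𝓝 uo) := by
  refine ⟨fun x hx => hD.exists_isUniqueMinimizer_totalCost xr ur hx, ?_⟩
  obtain ⟨x, z, hz⟩ := hfeas
  obtain ⟨xo, uo, ho, hs⟩ := hD.exists_optimal_reference xr ur ⟨z.h, hz.2.2.2.2⟩
  refine ⟨xo, uo, ho, hs, ?_, hD.isLyapunovStable hN ho, fun x₀ hx₀ => ?_⟩
  · rw [mem_interior_iff_mem_nhds]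
    filter_upwards [hD.eventually_exists_feasible hN xr ur hs.1 one_pos] with x hx
    obtain ⟨y, hy, -⟩ := hx
    exact ⟨y, hy⟩
  · obtain ⟨z, hz, hx0, hu0⟩ := hD.exists_optimalRun xr ur hx₀
    have hlim := hz.tendsto_state_input hD hN ho
    simp only [hx0, hu0] at hlim
    refine ⟨hD.closedLoopState_mem xr ur hx₀, fun t => ?_, hlim.fst_nhds, hlim.snd_nhds⟩
    have h := (hz.feasible t).2.1 0
    rwa [Fin.castSucc_zero', hx0, hu0] at h
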